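/- Let $\mathbb R_+=[0,\infty)$, let $0=x_0<x_1<x_2<\cdots$ with $x_k\to\infty$, and put $X=\{x_k\}_{k\ge1}$. Let $\alpha=(\alpha_k)_{k\ge1}$ be a real sequence and let $q\in L^\infty(\mathbb R_+)$ be real-valued. For $n\in\mathbb N$ and $p\in[1,\infty]$ let $$W^{n,p}(\mathbb R_+\setminus X)=\{f\in L^p(\mathbb R_+): f\in W^{n,p}[x_{k-1},x_k]\ (k\ge1),\ f^{(n)}\in L^p(\mathbb R_+)\},$$ where the derivatives of $f$ are taken on each interval $(x_{k-1},x_k)$ separately, and let $W^{n,p}_{\mathrm{comp}}(\mathbb R_+\setminus X)$ be the set of those $f\in W^{n,p}(\mathbb R_+\setminus X)$ that vanish almost everywhere on $(R,\infty)$ for some $R$. Put $\tau_qf=-f''+qf$, and consider the conditions $$(\ast)\qquad f(0)=0,\qquad f(x_k+)=f(x_k-),\quad f'(x_k+)-f'(x_k-)=\alpha_kf(x_k)\quad(k\ge1).$$ In the complex Hilbert space $L^2(\mathbb R_+)$ let $H^0_{X,\alpha,q}f=\tau_qf$ with $$\operatorname{dom}(H^0_{X,\alpha,q})=\{f\in W^{2,1}_{\mathrm{comp}}(\mathbb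 R_+\setminus X): f\text{ satisfies }(\ast),\ \tau_qf\in L^2(\mathbb R_+)\}.$$ Then $H^0_{X,\alpha,q}$ is closable; let $H=H_{X,\alpha,q}$ be its closure. The following hold. (i) $H$ is densely defined and symmetric. Its adjoint $H^*$ has the domain $$\operatorname{dom}(H^*)=\{f\in W^{2,2}(\mathbb R_+\setminus X): f\text{ satisfies }(\ast)\},$$ and $H^*f=\tau_qf$ for all $f\in\operatorname{dom}(H^*)$. (ii) Assume in addition that $d_*:=\inf_{k\ge1}(x_k-x_{k-1})>0$. Then $$\operatorname{dom}(H)\hookrightarrow\operatorname{dom}(H^*)\hookrightarrow W^{1,2}(\mathbb R_+),$$ and both embeddings are continuous, where $\operatorname{dom}(H)$ and $\operatorname{dom}(H^*)$ carry the graph norms of $H$ and $H^*$, and $W^{1,2}(\mathbb R_+)$ carries its usual norm $(\|f\|^2_{L^2}+\|f'\|^2_{L^2})^{1/2}$. -/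

import Mathlib

open MeasureTheory Filter Topology Set
open scoped ENNReal ContDiff

noncomputable section

namespace DeltaInteraction

/-- Lebesgue measure on the half-line `[0, ∞)`. -/
abbrev halfLine : Measure ℝ := volume.restrict (Ici (0 : ℝ))

/-- The complex Hilbert space `L²([0, ∞))`. -/
abbrev L2Half : Type := Lp ℂ 2 halfLine

/-! ### Weak derivatives, one-sided values, Sobolev spaces -/

/-- `g` is the weak (distributional) derivative of order `n` of `f` on the open set `U`. -/
def IsWeakDeriv (U : Set ℝ) (n : ℕ) (f g : ℝ → ℂ) : Prop :=
  LocallyIntegrableOn f U ∧ LocallyIntegrableOn g U ∧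
    ∀ φ : ℝ → ℝ, ContDiff ℝ ∞ φ → HasCompactSupport φ → tsupport φ ⊆ U →
      ∫ t, iteratedDeriv n φ t • f t = (-1) ^ n * ∫ t, φ t • g t

/-- `f(a+) = c`. The limit is taken up to Lebesgue null sets, so it only depends on the a.e. class
of `f`, and it is the right limit of any continuous representative of `f` on some `(a, a + ε)`. -/
def RightValue (f : ℝ → ℂ) (a : ℝ) (c : ℂ) : Prop :=
  Tendsto f (𝓝[>] a ⊓ ae volume) (𝓝 c)

/-- `f(a-) = c`, up to Lebesgue null sets as in `RightValue`. -/
def LeftValue (f : ℝ → ℂ) (a : ℝ) (c : ℂ) : Prop :=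
  Tendsto f (𝓝[<] a ⊓ ae volume) (𝓝 c)

/-- The Sobolev space `W^{n,p}` on the interval with end points `a`, `b`. -/
def MemSobolev (a b : ℝ) (n : ℕ) (p : ℝ≥0∞) (f : ℝ → ℂ) : Prop :=
  ∀ i ≤ n, ∃ g, IsWeakDeriv (Ioo a b) i f g ∧ MemLp g p (volume.restrict (Ioo a b))

/-- `g` is the `n`-th derivative of `f` on `[0, ∞) ∖ X`, i.e. on each interval between two
consecutive points of `0 = x 0 < x 1 < x 2 < ⋯`. -/
def IsPiecewiseDeriv (x : ℕ → ℝ) (n : ℕ) (f g : ℝ → ℂ) : Prop :=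
  ∀ k, IsWeakDeriv (Ioo (x k) (x (k + 1))) n f g

/-- The space `W^{n,p}([0, ∞) ∖ X)`: `f ∈ L^p`, `f ∈ W^{n,p}[x_{k-1}, x_k]` for all `k ≥ 1`, and
`f^{(n)} ∈ L^p`. -/
def MemPiecewiseSobolev (x : ℕ → ℝ) (n : ℕ) (p : ℝ≥0∞) (f : ℝ → ℂ) : Prop :=
  MemLp f p halfLine ∧ (∀ k, MemSobolev (x k) (x (k + 1)) n p f) ∧
    ∃ g, IsPiecewiseDeriv x n f g ∧ MemLp g p halfLine

/-- The support of `f` is bounded (up to null sets) in `[0, ∞)`. -/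
def HasBoundedSupport (f : ℝ → ℂ) : Prop :=
  ∃ R : ℝ, ∀ᵐ t ∂halfLine, R < t → f t = 0

/-- The boundary condition `f(0) = 0` and, for all `k ≥ 1`, the conditions
`f(x_k+) = f(x_k-)` and `f'(x_k+) - f'(x_k-) = α_k f(x_k)`. -/
def DeltaConditions (x α : ℕ → ℝ) (f : ℝ → ℂ) : Prop :=
  RightValue f 0 0 ∧
    ∃ f' : ℝ → ℂ, IsPiecewiseDeriv x 1 f f' ∧ ∀ k, 1 ≤ k → ∃ c a b : ℂ,
      LeftValue f (x k) c ∧ RightValue f (x k) c ∧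
      LeftValue f' (x k) a ∧ RightValue f' (x k) b ∧ b - a = α k * c

/-- `h = τ_q f = -f'' + q f` almost everywhere, where `f''` is taken on `[0, ∞) ∖ X`. -/
def IsTau (x : ℕ → ℝ) (q : ℝ → ℝ) (f h : ℝ → ℂ) : Prop :=
  ∃ f'' : ℝ → ℂ, IsPiecewiseDeriv x 2 f f'' ∧ h =ᵐ[halfLine] fun t => -f'' t + q t * f t

/-- A discrete set `X = {x_1, x_2, …}` of interaction centres with `0 = x_0 < x_1 < x_2 < ⋯` and
`x_k → ∞`. -/
structure Centers where
  x : ℕ → ℝ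
  x_zero : x 0 = 0
  strictMono : StrictMono x
  tendsto : Tendsto x atTop atTop

/-! ### Linearity and invariance under a.e. equality -/

theorem integrable_testFun_smul {U : Set ℝ} {f : ℝ → ℂ} (hf : LocallyIntegrableOn f U)
    {ψ : ℝ → ℝ} (hψ : Continuous ψ) (hc : HasCompactSupport ψ) (hU : tsupport ψ ⊆ U) :
    Integrable fun t => ψ t • f t := by
  have h1 : IntegrableOn f (tsupport ψ) := hf.integrableOn_compact_subset hU hc
  have h2 : IntegrableOn (fun t => ψ t • f t) (tsupport ψ) :=
    h1.continuousOn_smul hψ.continuousOn hc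
  refine (integrableOn_iff_integrable_of_support_subset ?_).1 h2
  intro t ht
  refine subset_tsupport ψ ?_
  intro h0
  exact ht (by simp [h0])

theorem continuous_iteratedDeriv_testFun {φ : ℝ → ℝ} (hφ : ContDiff ℝ ∞ φ) (n : ℕ) :
    Continuous (iteratedDeriv n φ) :=
  hφ.continuous_iteratedDeriv n (by exact_mod_cast le_top)

theorem tsupport_iteratedDeriv_testFun (φ : ℝ → ℝ) (n : ℕ) :
    tsupport (iteratedDeriv n φ) ⊆ tsupport φ := by
  induction n with
  | zero => simp
  | succ n ih =>
    rw [iteratedDeriv_succ]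
    exact (closure_minimal support_deriv_subset (isClosed_tsupport _)).trans ih

theorem IsWeakDeriv.add {U : Set ℝ} {n : ℕ} {f g f₁ g₁ : ℝ → ℂ} (h : IsWeakDeriv U n f f₁)
    (h' : IsWeakDeriv U n g g₁) : IsWeakDeriv U n (f + g) (f₁ + g₁) := by
  refine ⟨h.1.add h'.1, h.2.1.add h'.2.1, fun φ h1 h2 h3 => ?_⟩
  have hc := continuous_iteratedDeriv_testFun h1 n
  have hs := tsupport_iteratedDeriv_testFun φ n
  have hk : HasCompactSupport (iteratedDeriv n φ) :=
    h2.of_isClosed_subset (isClosed_tsupport _) hs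
  simp only [Pi.add_apply, smul_add]
  rw [integral_add (integrable_testFun_smul h.1 hc hk (hs.trans h3))
    (integrable_testFun_smul h'.1 hc hk (hs.trans h3)),
    integral_add (integrable_testFun_smul h.2.1 h1.continuous h2 h3)
    (integrable_testFun_smul h'.2.1 h1.continuous h2 h3),
    h.2.2 φ h1 h2 h3, h'.2.2 φ h1 h2 h3]
  ring

theorem IsWeakDeriv.smul {U : Set ℝ} {n : ℕ} {f f₁ : ℝ → ℂ} (c : ℂ) (h : IsWeakDeriv U n f f₁) :
    IsWeakDeriv U n (c • f) (c • f₁) := by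
  refine ⟨h.1.smul c, h.2.1.smul c, fun φ h1 h2 h3 => ?_⟩
  have := h.2.2 φ h1 h2 h3
  simp only [Pi.smul_apply, smul_comm _ c]
  rw [integral_smul, integral_smul, this]
  simp only [smul_eq_mul]
  ring

theorem IsWeakDeriv.congr {U : Set ℝ} (hU : MeasurableSet U) {n : ℕ} {f g f₁ g₁ : ℝ → ℂ}
    (h : IsWeakDeriv U n f f₁) (hf : f =ᵐ[volume.restrict U] g)
    (hg : f₁ =ᵐ[volume.restrict U] g₁) : IsWeakDeriv U n g g₁ := by
  have key : ∀ {u v : ℝ → ℂ}, LocallyIntegrableOn u U → u =ᵐ[volume.restrict U] v →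
      LocallyIntegrableOn v U := by
    intro u v hu huv t ht
    obtain ⟨s, hs, hi⟩ := hu t ht
    refine ⟨s ∩ U, inter_mem hs self_mem_nhdsWithin, ?_⟩
    refine (hi.mono_set inter_subset_left).congr ?_
    exact ae_restrict_of_ae_restrict_of_subset inter_subset_right huv
  have key2 : ∀ {u v : ℝ → ℂ} {ψ : ℝ → ℝ}, u =ᵐ[volume.restrict U] v → tsupport ψ ⊆ U →
      ∫ t, ψ t • u t = ∫ t, ψ t • v t := by
    intro u v ψ huv hψ
    refine integral_congr_ae ?_
    filter_upwards [(ae_restrict_iff' hU).1 huv] with t ht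
    by_cases h0 : ψ t = 0
    · simp [h0]
    · rw [ht (hψ (subset_tsupport ψ h0))]
  refine ⟨key h.1 hf, key h.2.1 hg, fun φ h1 h2 h3 => ?_⟩
  rw [← key2 hf ((tsupport_iteratedDeriv_testFun φ n).trans h3), ← key2 hg h3]
  exact h.2.2 φ h1 h2 h3

theorem IsWeakDeriv.unique {U : Set ℝ} (hU : IsOpen U) {n : ℕ} {f g g' : ℝ → ℂ}
    (h : IsWeakDeriv U n f g) (h' : IsWeakDeriv U n f g') : g =ᵐ[volume.restrict U] g' := by
  have hh : IsWeakDeriv U n (f + (-1 : ℂ) • f) (g + (-1 : ℂ) • g') := h.add (h'.smul _)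
  have h0 := hU.ae_eq_zero_of_integral_contDiff_smul_eq_zero hh.2.1 (fun φ h1 h2 h3 => by
    have := hh.2.2 φ h1 h2 h3
    have hz : (f + (-1 : ℂ) • f) = 0 := by ext t; simp
    rw [hz] at this
    simpa using this.symm)
  refine (ae_restrict_iff' hU.measurableSet).2 ?_
  filter_upwards [h0] with t ht htU
  have := ht htU
  simp only [Pi.add_apply, Pi.smul_apply, smul_eq_mul, neg_mul, one_mul] at this
  exact add_neg_eq_zero.1 this

/-- The weak derivative of the zero function is zero. -/
theorem IsWeakDeriv.zero (U : Set ℝ) (n : ℕ) : IsWeakDeriv U n 0 0 := by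
  refine ⟨?_, ?_, fun φ _ _ _ => by simp⟩ <;> exact locallyIntegrable_zero.locallyIntegrableOn U

/-- `f` is determined up to null sets in `[0, ∞)`; restrict an a.e. equality to a subset. -/
theorem ae_restrict_of_halfLine {f g : ℝ → ℂ} (h : f =ᵐ[halfLine] g) {U : Set ℝ}
    (hU : U ⊆ Ici 0) : f =ᵐ[volume.restrict U] g :=
  ae_restrict_of_ae_restrict_of_subset hU h

theorem Centers.nonneg (X : Centers) (k : ℕ) : 0 ≤ X.x k := by
  rw [← X.x_zero]
  exact X.strictMono.monotone (Nat.zero_le k)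

theorem Centers.Ioo_subset (X : Centers) (k : ℕ) : Ioo (X.x k) (X.x (k + 1)) ⊆ Ici 0 :=
  fun _ ht => (X.nonneg k).trans ht.1.le

/-- The intervals between consecutive centres exhaust `[0, ∞)` up to a null set. -/
theorem Centers.ae_of_forall_Ioo (X : Centers) {P : ℝ → Prop}
    (h : ∀ k, ∀ᵐ t ∂(volume.restrict (Ioo (X.x k) (X.x (k + 1)))), P t) :
    ∀ᵐ t ∂halfLine, P t := by
  have h1 : ∀ᵐ t ∂(volume : Measure ℝ), ∀ k, t ∈ Ioo (X.x k) (X.x (k + 1)) → P t :=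
    ae_all_iff.2 fun k => (ae_restrict_iff' measurableSet_Ioo).1 (h k)
  have h2 : ∀ᵐ t ∂(volume : Measure ℝ), t ∉ range X.x :=
    (countable_range X.x).ae_notMem volume
  refine (ae_restrict_iff' measurableSet_Ici).2 ?_
  filter_upwards [h1, h2] with t ht htX ht0
  obtain ⟨m, hm⟩ := (X.tendsto.eventually_gt_atTop t).exists
  classical
  have hex : ∃ m, t < X.x m := ⟨m, hm⟩
  have hpos : Nat.find hex ≠ 0 := by
    intro h0
    have := Nat.find_spec hex
    rw [h0, X.x_zero] at this
    exact absurd ht0 (not_le.2 this)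
  obtain ⟨k, hk⟩ := Nat.exists_eq_succ_of_ne_zero hpos
  have hlt : t < X.x (k + 1) := by
    have := Nat.find_spec hex
    rwa [hk] at this
  have hle : X.x k ≤ t := not_lt.1 (Nat.find_min hex (by omega))
  exact ht k ⟨lt_of_le_of_ne hle fun e => htX ⟨k, e⟩, hlt⟩

theorem ae_right_of_halfLine {f g : ℝ → ℂ} (h : f =ᵐ[halfLine] g) {a : ℝ} (ha : 0 ≤ a) :
    f =ᶠ[𝓝[>] a ⊓ ae volume] g := by
  have h1 := (ae_restrict_iff' measurableSet_Ici).1 h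
  have h2 : ∀ᶠ t in 𝓝[>] a ⊓ ae (volume : Measure ℝ), t ∈ Ici (0 : ℝ) → f t = g t :=
    h1.filter_mono inf_le_right
  have h3 : ∀ᶠ t in 𝓝[>] a ⊓ ae (volume : Measure ℝ), a < t :=
    (eventually_mem_nhdsWithin (s := Ioi a)).filter_mono inf_le_left
  filter_upwards [h2, h3] with t ht hat
  exact ht (ha.trans hat.le)

theorem ae_left_of_halfLine {f g : ℝ → ℂ} (h : f =ᵐ[halfLine] g) {a : ℝ} (ha : 0 < a) :
    f =ᶠ[𝓝[<] a ⊓ ae volume] g := by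
  have h1 := (ae_restrict_iff' measurableSet_Ici).1 h
  have h2 : ∀ᶠ t in 𝓝[<] a ⊓ ae (volume : Measure ℝ), t ∈ Ici (0 : ℝ) → f t = g t :=
    h1.filter_mono inf_le_right
  have h3 : ∀ᶠ t in 𝓝[<] a ⊓ ae (volume : Measure ℝ), 0 < t :=
    Filter.Eventually.filter_mono inf_le_left (mem_nhdsWithin_of_mem_nhds (Ioi_mem_nhds ha))
  filter_upwards [h2, h3] with t ht hat
  exact ht hat.le

section Predicates

variable {X : Centers} {α : ℕ → ℝ} {q : ℝ → ℝ} {n : ℕ} {p : ℝ≥0∞} {f g f₁ g₁ h k : ℝ → ℂ}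

theorem MemPiecewiseSobolev.zero : MemPiecewiseSobolev X.x n p 0 :=
  ⟨MemLp.zero, fun _ _ _ => ⟨0, .zero _ _, MemLp.zero⟩, 0, fun _ => .zero _ _, MemLp.zero⟩

theorem MemPiecewiseSobolev.add (hf : MemPiecewiseSobolev X.x n p f)
    (hg : MemPiecewiseSobolev X.x n p g) : MemPiecewiseSobolev X.x n p (f + g) := by
  obtain ⟨a1, a2, u, a3, a4⟩ := hf
  obtain ⟨b1, b2, v, b3, b4⟩ := hg
  refine ⟨a1.add b1, fun k i hi => ?_, u + v, fun k => (a3 k).add (b3 k), a4.add b4⟩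
  obtain ⟨u', c1, c2⟩ := a2 k i hi
  obtain ⟨v', d1, d2⟩ := b2 k i hi
  exact ⟨u' + v', c1.add d1, c2.add d2⟩

theorem MemPiecewiseSobolev.smul (c : ℂ) (hf : MemPiecewiseSobolev X.x n p f) :
    MemPiecewiseSobolev X.x n p (c • f) := by
  obtain ⟨a1, a2, u, a3, a4⟩ := hf
  refine ⟨a1.const_smul c, fun k i hi => ?_, c • u, fun k => (a3 k).smul c, a4.const_smul c⟩
  obtain ⟨u', c1, c2⟩ := a2 k i hi
  exact ⟨c • u', c1.smul c, c2.const_smul c⟩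

theorem IsPiecewiseDeriv.congr (h : IsPiecewiseDeriv X.x n f g) (hf : f =ᵐ[halfLine] f₁) :
    IsPiecewiseDeriv X.x n f₁ g :=
  fun k => (h k).congr measurableSet_Ioo (ae_restrict_of_halfLine hf (X.Ioo_subset k)) .rfl

theorem MemPiecewiseSobolev.congr (hf : MemPiecewiseSobolev X.x n p f) (e : f =ᵐ[halfLine] g) :
    MemPiecewiseSobolev X.x n p g := by
  obtain ⟨a1, a2, u, a3, a4⟩ := hf
  refine ⟨a1.ae_eq e, fun k i hi => ?_, u, a3.congr e, a4⟩
  obtain ⟨u', c1, c2⟩ := a2 k i hi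
  exact ⟨u', c1.congr measurableSet_Ioo (ae_restrict_of_halfLine e (X.Ioo_subset k)) .rfl, c2⟩

theorem HasBoundedSupport.add (hf : HasBoundedSupport f) (hg : HasBoundedSupport g) :
    HasBoundedSupport (f + g) := by
  obtain ⟨R, hR⟩ := hf
  obtain ⟨S, hS⟩ := hg
  refine ⟨max R S, ?_⟩
  filter_upwards [hR, hS] with t h1 h2 h3
  simp [h1 ((le_max_left _ _).trans_lt h3), h2 ((le_max_right _ _).trans_lt h3)]

theorem HasBoundedSupport.smul (c : ℂ) (hf : HasBoundedSupport f) :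
    HasBoundedSupport (c • f) := by
  obtain ⟨R, hR⟩ := hf
  refine ⟨R, ?_⟩
  filter_upwards [hR] with t h1 h3
  simp [h1 h3]

theorem HasBoundedSupport.congr (hf : HasBoundedSupport f) (e : f =ᵐ[halfLine] g) :
    HasBoundedSupport g := by
  obtain ⟨R, hR⟩ := hf
  refine ⟨R, ?_⟩
  filter_upwards [hR, e] with t h1 h2 h3
  rw [← h2, h1 h3]

theorem DeltaConditions.zero : DeltaConditions X.x α 0 :=
  ⟨tendsto_const_nhds, 0, fun _ => .zero _ _, fun _ _ => ⟨0, 0, 0, tendsto_const_nhds,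
    tendsto_const_nhds, tendsto_const_nhds, tendsto_const_nhds, by simp⟩⟩

theorem DeltaConditions.add (hf : DeltaConditions X.x α f) (hg : DeltaConditions X.x α g) :
    DeltaConditions X.x α (f + g) := by
  obtain ⟨a1, u, a2, a3⟩ := hf
  obtain ⟨b1, v, b2, b3⟩ := hg
  have h0 : RightValue (f + g) 0 (0 + 0) := Tendsto.add a1 b1
  rw [add_zero] at h0
  refine ⟨h0, u + v, fun k => (a2 k).add (b2 k),
    fun k hk => ?_⟩
  obtain ⟨c, a, b, h1, h2, h3, h4, h5⟩ := a3 k hk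
  obtain ⟨c', a', b', h1', h2', h3', h4', h5'⟩ := b3 k hk
  exact ⟨c + c', a + a', b + b', Tendsto.add h1 h1', Tendsto.add h2 h2', Tendsto.add h3 h3',
    Tendsto.add h4 h4', by linear_combination h5 + h5'⟩

theorem DeltaConditions.smul (s : ℂ) (hf : DeltaConditions X.x α f) :
    DeltaConditions X.x α (s • f) := by
  obtain ⟨a1, u, a2, a3⟩ := hf
  have h0 : RightValue (s • f) 0 (s • 0) := Tendsto.const_smul a1 s
  rw [smul_zero] at h0
  refine ⟨h0, s • u, fun k => (a2 k).smul s,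
    fun k hk => ?_⟩
  obtain ⟨c, a, b, h1, h2, h3, h4, h5⟩ := a3 k hk
  exact ⟨s • c, s • a, s • b, Tendsto.const_smul h1 s, Tendsto.const_smul h2 s,
    Tendsto.const_smul h3 s, Tendsto.const_smul h4 s, by
      simp only [smul_eq_mul]; linear_combination s * h5⟩

theorem DeltaConditions.congr (hf : DeltaConditions X.x α f) (e : f =ᵐ[halfLine] g) :
    DeltaConditions X.x α g := by
  obtain ⟨a1, u, a2, a3⟩ := hf
  refine ⟨Tendsto.congr' (ae_right_of_halfLine e le_rfl) a1, u, a2.congr e, fun k hk => ?_⟩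
  obtain ⟨c, a, b, h1, h2, h3, h4, h5⟩ := a3 k hk
  have hpos : 0 < X.x k := by
    rw [← X.x_zero]
    exact X.strictMono hk
  exact ⟨c, a, b, Tendsto.congr' (ae_left_of_halfLine e hpos) h1,
    Tendsto.congr' (ae_right_of_halfLine e hpos.le) h2, h3, h4, h5⟩

theorem IsTau.zero : IsTau X.x q 0 0 :=
  ⟨0, fun _ => .zero _ _, by filter_upwards with t; simp⟩

theorem IsTau.add (hf : IsTau X.x q f f₁) (hg : IsTau X.x q g g₁) :
    IsTau X.x q (f + g) (f₁ + g₁) := by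
  obtain ⟨u, a1, a2⟩ := hf
  obtain ⟨v, b1, b2⟩ := hg
  refine ⟨u + v, fun k => (a1 k).add (b1 k), ?_⟩
  filter_upwards [a2, b2] with t h1 h2
  simp only [Pi.add_apply, h1, h2]
  ring

theorem IsTau.smul (c : ℂ) (hf : IsTau X.x q f f₁) : IsTau X.x q (c • f) (c • f₁) := by
  obtain ⟨u, a1, a2⟩ := hf
  refine ⟨c • u, fun k => (a1 k).smul c, ?_⟩
  filter_upwards [a2] with t h1
  simp only [Pi.smul_apply, smul_eq_mul, h1]
  ring

theorem IsTau.congr (hf : IsTau X.x q f f₁) (e : f =ᵐ[halfLine] g) (e' : f₁ =ᵐ[halfLine] g₁) :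
    IsTau X.x q g g₁ := by
  obtain ⟨u, a1, a2⟩ := hf
  refine ⟨u, a1.congr e, ?_⟩
  filter_upwards [a2, e, e'] with t h1 h2 h3
  rw [← h3, h1, h2]

theorem IsTau.unique (hf : IsTau X.x q f h) (hg : IsTau X.x q f k) : h =ᵐ[halfLine] k := by
  obtain ⟨u, a1, a2⟩ := hf
  obtain ⟨v, b1, b2⟩ := hg
  have huv : u =ᵐ[halfLine] v :=
    X.ae_of_forall_Ioo fun k => (a1 k).unique isOpen_Ioo (b1 k)
  filter_upwards [a2, b2, huv] with t h1 h2 h3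
  rw [h1, h2, h3]

end Predicates

/-! ### The operators -/

/-- The graph of `H⁰_{X,α,q}`: the pairs `(f, τ_q f)` of elements of `L²` with
`f ∈ W^{2,1}_comp([0, ∞) ∖ X)` satisfying the boundary conditions. -/
def preHamiltonianGraph (X : Centers) (α : ℕ → ℝ) (q : ℝ → ℝ) :
    Submodule ℂ (L2Half × L2Half) where
  carrier := {z | (MemPiecewiseSobolev X.x 2 1 z.1 ∧ HasBoundedSupport z.1) ∧
    DeltaConditions X.x α z.1 ∧ IsTau X.x q z.1 z.2}
  zero_mem' := by
    have e : (0 : ℝ → ℂ) =ᵐ[halfLine] ((0 : L2Half) : ℝ → ℂ) := (Lp.coeFn_zero ℂ 2 halfLine).symm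
    have hb : HasBoundedSupport 0 := ⟨0, by filter_upwards with t _; rfl⟩
    exact ⟨⟨MemPiecewiseSobolev.zero.congr e, hb.congr e⟩, DeltaConditions.zero.congr e,
      IsTau.zero.congr e e⟩
  add_mem' := by
    rintro ⟨f, h⟩ ⟨g, k⟩ ⟨⟨a1, a2⟩, a3, a4⟩ ⟨⟨b1, b2⟩, b3, b4⟩
    have e := (Lp.coeFn_add f g).symm
    have e' := (Lp.coeFn_add h k).symm
    exact ⟨⟨(a1.add b1).congr e, (a2.add b2).congr e⟩, (a3.add b3).congr e,
      (a4.add b4).congr e e'⟩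
  smul_mem' := by
    rintro c ⟨f, h⟩ ⟨⟨a1, a2⟩, a3, a4⟩
    have e := (Lp.coeFn_smul c f).symm
    have e' := (Lp.coeFn_smul c h).symm
    exact ⟨⟨(a1.smul c).congr e, (a2.smul c).congr e⟩, (a3.smul c).congr e,
      (a4.smul c).congr e e'⟩

/-- The operator `H⁰_{X,α,q}` in `L²([0, ∞))`, given by its graph. -/
def preHamiltonian (X : Centers) (α : ℕ → ℝ) (q : ℝ → ℝ) : L2Half →ₗ.[ℂ] L2Half :=
  (preHamiltonianGraph X α q).toLinearPMap

/-- `preHamiltonianGraph` is single-valued, so it is the graph of `preHamiltonian`. -/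
theorem graph_preHamiltonian (X : Centers) (α : ℕ → ℝ) (q : ℝ → ℝ) :
    (preHamiltonian X α q).graph = preHamiltonianGraph X α q := by
  refine Submodule.toLinearPMap_graph_eq _ ?_
  rintro ⟨f, h⟩ ⟨-, -, hf⟩ (rfl : f = 0)
  have e : (0 : ℝ → ℂ) =ᵐ[halfLine] ((0 : L2Half) : ℝ → ℂ) := (Lp.coeFn_zero ℂ 2 halfLine).symm
  exact Lp.ext (hf.unique (IsTau.zero.congr e e))

/-- The Hamiltonian `H_{X,α,q}` with `δ`-interactions on `X`: the closure of `H⁰_{X,α,q}`. -/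
def hamiltonian (X : Centers) (α : ℕ → ℝ) (q : ℝ → ℝ) : L2Half →ₗ.[ℂ] L2Half :=
  (preHamiltonian X α q).closure

/-- The pairs `(f, f')` of elements of `L²([0, ∞))`, with `f'` the weak derivative of `f` on the
whole of `(0, ∞)`. -/
def derivativeGraph : Submodule ℂ (L2Half × L2Half) where
  carrier := {z | IsWeakDeriv (Ioi 0) 1 z.1 z.2}
  zero_mem' := by
    have e : (0 : ℝ → ℂ) =ᵐ[volume.restrict (Ioi 0)] ((0 : L2Half) : ℝ → ℂ) :=
      ae_restrict_of_halfLine (Lp.coeFn_zero ℂ 2 halfLine).symm Ioi_subset_Ici_self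
    exact (IsWeakDeriv.zero _ _).congr measurableSet_Ioi e e
  add_mem' := by
    rintro ⟨f, h⟩ ⟨g, k⟩ a b
    exact (IsWeakDeriv.add a b).congr measurableSet_Ioi
      (ae_restrict_of_halfLine (Lp.coeFn_add f g).symm Ioi_subset_Ici_self)
      (ae_restrict_of_halfLine (Lp.coeFn_add h k).symm Ioi_subset_Ici_self)
  smul_mem' := by
    rintro c ⟨f, h⟩ a
    exact (IsWeakDeriv.smul c a).congr measurableSet_Ioi
      (ae_restrict_of_halfLine (Lp.coeFn_smul c f).symm Ioi_subset_Ici_self)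
      (ae_restrict_of_halfLine (Lp.coeFn_smul c h).symm Ioi_subset_Ici_self)

/-- The weak derivative as an operator in `L²([0, ∞))`; its domain is the Sobolev space
`W^{1,2}([0, ∞))`. -/
def weakDerivative : L2Half →ₗ.[ℂ] L2Half :=
  derivativeGraph.toLinearPMap

/-- `derivativeGraph` is single-valued, so it is the graph of `weakDerivative`. -/
theorem graph_weakDerivative : weakDerivative.graph = derivativeGraph := by
  refine Submodule.toLinearPMap_graph_eq _ ?_
  rintro ⟨f, h⟩ hf (rfl : f = 0)
  have e : (0 : ℝ → ℂ) =ᵐ[volume.restrict (Ioi 0)] ((0 : L2Half) : ℝ → ℂ) :=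
    ae_restrict_of_halfLine (Lp.coeFn_zero ℂ 2 halfLine).symm Ioi_subset_Ici_self
  have h1 : (h : ℝ → ℂ) =ᵐ[volume.restrict (Ioi 0)] ((0 : L2Half) : ℝ → ℂ) :=
    IsWeakDeriv.unique isOpen_Ioi hf ((IsWeakDeriv.zero _ _).congr measurableSet_Ioi e e)
  refine Lp.ext ?_
  have h2 : halfLine = volume.restrict (Ioi 0) := Measure.restrict_congr_set Ioi_ae_eq_Ici.symm
  rwa [← h2] at h1

/-- The Sobolev space `W^{1,2}([0, ∞))`, as a subspace of `L²([0, ∞))`. -/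
def W12 : Submodule ℂ L2Half := weakDerivative.domain

/-- The norm `(‖f‖² + ‖f'‖²)^{1/2}` of `W^{1,2}([0, ∞))`. -/
def W12Norm (f : W12) : ℝ := √(‖(f : L2Half)‖ ^ 2 + ‖weakDerivative f‖ ^ 2)

/-- The graph norm `(‖f‖² + ‖T f‖²)^{1/2}` on the domain of an operator `T`. -/
def graphNorm (T : L2Half →ₗ.[ℂ] L2Half) (f : T.domain) : ℝ :=
  √(‖(f : L2Half)‖ ^ 2 + ‖T f‖ ^ 2)

/-- `D₁ ⊆ D₂`, and the inclusion is bounded (that is, continuous) from the norm `N₁` to the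
norm `N₂`. -/
def ContinuouslyEmbedded (D₁ D₂ : Submodule ℂ L2Half) (N₁ : D₁ → ℝ) (N₂ : D₂ → ℝ) : Prop :=
  ∃ hle : D₁ ≤ D₂, ∃ C : ℝ, ∀ f : D₁, N₂ (Submodule.inclusion hle f) ≤ C * N₁ f

end DeltaInteraction

end

noncomputable section

namespace DeltaInteraction

/-! ### Primitives of integrable functions -/

/-! If `f` and `τ_q f` are in `L²`, then, `q` being bounded, so is `f''`. On every interval `[x_k,
x_{k+1}]` such an `f` therefore agrees a.e. with a continuously differentiable function whose
derivative is a primitive of `f''` (`IsTau.exists_hasPieces`). Hence all one-sided values exist, and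
(∗) becomes a list of equations between end point values (`deltaConditions_iff`).

By Green's formula on each interval, `⟨τf, g⟩ - ⟨f, τg⟩` is a sum of boundary terms when `g` has
bounded support. If both functions satisfy (∗), the form `conj f · g' - conj f' · g` takes the same
value on both sides of every centre, because `α` is real. The sum telescopes, and both ends vanish
(`inner_eq_of_isTau`). So `H⁰` is symmetric, and the domain claimed for `H*` belongs to the adjoint.
Conversely, test functions inside the intervals show that an element of the adjoint graph is a pair
`(f, τ_q f)` (`isTau_of_forall_inner_eq`). Functions in the domain with prescribed data at a single
centre then give back (∗) (`matches_of_forall_inner_eq`). Density holds because the test functions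
inside the intervals lie in the domain; closability follows since `H⁰` is contained in its closed
adjoint.

For (ii), integrate `|f'|²` by parts over one interval. The boundary terms are estimated on
subintervals of length `d` at the two ends, by Green's formula against cubic polynomials
(`exists_endpoint_bound`). The resulting constant depends on `d` only, so the estimates can be
summed over all intervals (`exists_interpolation`, `memLp_glue_deriv`); the numbers `α_k` do not
enter. Continuity at the centres makes the piecewise derivative a weak derivative on the whole
half-line (`isWeakDeriv_glue`). -/

/-- On `[a, b]`, the function `F` is a primitive of the integrable function `f`. -/
structure IsPrimitiveOn (a b : ℝ) (F f : ℝ → ℂ) : Prop where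
  integrable : IntervalIntegrable f volume a b
  eq : ∀ t ∈ Icc a b, F t = F a + ∫ s in a..t, f s

theorem absolutelyContinuousOnInterval_const {E : Type*} [SeminormedAddCommGroup E] (c : E)
    (a b : ℝ) : AbsolutelyContinuousOnInterval (fun _ : ℝ => c) a b :=
  (LipschitzWith.const c).lipschitzOnWith.absolutelyContinuousOnInterval

/-- Real and imaginary parts have absolutely continuous primitives; these are recombined with the
scalars `1` and `I`. -/
theorem absolutelyContinuousOnInterval_primitive {a b : ℝ} {f : ℝ → ℂ}
    (hf : IntervalIntegrable f volume a b) (c : ℂ) :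
    AbsolutelyContinuousOnInterval (fun t => c + ∫ s in a..t, f s) a b := by
  have hre : IntervalIntegrable (fun t => (f t).re) volume a b := ⟨hf.1.re, hf.2.re⟩
  have him : IntervalIntegrable (fun t => (f t).im) volume a b := ⟨hf.1.im, hf.2.im⟩
  have h1 := (hre.absolutelyContinuousOnInterval_intervalIntegral
    (c := a) left_mem_uIcc).fun_smul (absolutelyContinuousOnInterval_const (1 : ℂ) a b)
  have h2 := (him.absolutelyContinuousOnInterval_intervalIntegral
    (c := a) left_mem_uIcc).fun_smul (absolutelyContinuousOnInterval_const Complex.I a b)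
  have h3 := (absolutelyContinuousOnInterval_const c a b).fun_add (h1.fun_add h2)
  -- Absolute continuity evaluates the function only at points of `uIcc a b`, so the two expressions
  -- need to agree only there.
  rw [absolutelyContinuousOnInterval_iff] at h3 ⊢
  intro ε hε
  obtain ⟨δ, hδ, H⟩ := h3 ε hε
  have key : ∀ t ∈ uIcc a b, (c + ∫ s in a..t, f s) =
      c + ((∫ s in a..t, (f s).re) • (1 : ℂ) + (∫ s in a..t, (f s).im) • Complex.I) := by
    intro t ht
    have hft : IntervalIntegrable f volume a t := hf.mono_set (uIcc_subset_uIcc_left ht)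
    congr 1
    have h4 : IntervalIntegrable (fun s => (((f s).re : ℝ) : ℂ)) volume a t :=
      ⟨hft.1.re.ofReal, hft.2.re.ofReal⟩
    have h5 : IntervalIntegrable (fun s => (((f s).im : ℝ) : ℂ) * Complex.I) volume a t :=
      ⟨hft.1.im.ofReal.mul_const _, hft.2.im.ofReal.mul_const _⟩
    simp only [Complex.real_smul, mul_one]
    rw [← intervalIntegral.integral_ofReal, ← intervalIntegral.integral_ofReal,
      ← intervalIntegral.integral_mul_const, ← intervalIntegral.integral_add h4 h5]
    simp only [Complex.re_add_im]
  refine ⟨δ, hδ, fun E hE hlt => ?_⟩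
  have := H E hE hlt
  refine lt_of_eq_of_lt (Finset.sum_congr rfl fun i hi => ?_) this
  have h6 := hE.1 i hi
  rw [key _ h6.1, key _ h6.2]

namespace IsPrimitiveOn

variable {a b : ℝ} {F f G g : ℝ → ℂ}

theorem of_integrable (hf : IntervalIntegrable f volume a b) (c : ℂ) :
    IsPrimitiveOn a b (fun t => c + ∫ s in a..t, f s) f :=
  ⟨hf, fun t _ => by simp⟩

theorem continuousOn (hab : a ≤ b) (h : IsPrimitiveOn a b F f) : ContinuousOn F (Icc a b) := by
  have := (absolutelyContinuousOnInterval_primitive h.integrable (F a)).continuousOn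
  rw [uIcc_of_le hab] at this
  exact this.congr h.eq

theorem intervalIntegrable (hab : a ≤ b) (h : IsPrimitiveOn a b F f) :
    IntervalIntegrable F volume a b :=
  ContinuousOn.intervalIntegrable (by rw [uIcc_of_le hab]; exact h.continuousOn hab)

theorem of_hasDerivAt (hF : ∀ t, HasDerivAt F (f t) t) (hf : Continuous f) :
    IsPrimitiveOn a b F f := by
  refine ⟨hf.intervalIntegrable _ _, fun t _ => ?_⟩
  rw [intervalIntegral.integral_eq_sub_of_hasDerivAt (fun s _ => hF s)
    (hf.intervalIntegrable _ _)]
  ring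

theorem conj (h : IsPrimitiveOn a b F f) :
    IsPrimitiveOn a b (fun t => starRingEnd ℂ (F t)) (fun t => starRingEnd ℂ (f t)) := by
  refine ⟨⟨?_, ?_⟩, fun t ht => ?_⟩
  · exact (Complex.conjLIE.toLinearIsometry.toContinuousLinearMap).integrable_comp h.integrable.1
  · exact (Complex.conjLIE.toLinearIsometry.toContinuousLinearMap).integrable_comp h.integrable.2
  · rw [h.eq t ht, map_add, intervalIntegral.integral_of_le ht.1,
      intervalIntegral.integral_of_le ht.1, integral_conj]

/-- Integration by parts. -/
theorem integral_mul (hab : a ≤ b) (h : IsPrimitiveOn a b F f) (h' : IsPrimitiveOn a b G g) :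
    ∫ t in a..b, (F t * g t + f t * G t) = F b * G b - F a * G a := by
  have hFc : ContinuousOn F (uIcc a b) := by rw [uIcc_of_le hab]; exact h.continuousOn hab
  have hGc : ContinuousOn G (uIcc a b) := by rw [uIcc_of_le hab]; exact h'.continuousOn hab
  have hint : IntervalIntegrable (fun t => F t * g t + f t * G t) volume a b :=
    (h'.integrable.continuousOn_mul hFc).add (h.integrable.mul_continuousOn hGc)
  have hF := absolutelyContinuousOnInterval_primitive h.integrable (F a)
  have hG := absolutelyContinuousOnInterval_primitive h'.integrable (G a)
  have hP := absolutelyContinuousOnInterval_primitive hint 0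
  -- The product minus a primitive of `F g + f G` is absolutely continuous with derivative zero
  -- a.e., hence constant.
  have hD := (hF.fun_smul hG).fun_sub hP
  obtain ⟨C, hC⟩ := hD.const_of_ae_hasDerivAt_zero (by
    filter_upwards [h.integrable.ae_hasDerivAt_integral, h'.integrable.ae_hasDerivAt_integral,
      hint.ae_hasDerivAt_integral] with t h1 h2 h3 ht
    have e1 := (h1 ht a left_mem_uIcc).const_add (F a)
    have e2 := (h2 ht a left_mem_uIcc).const_add (G a)
    have e3 := (h3 ht a left_mem_uIcc).const_add 0
    have e4 := (e1.mul e2).sub e3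
    rw [uIcc_of_le hab] at ht
    rw [show _ - (F t * g t + f t * G t) = (0 : ℂ) by
      rw [h.eq t ht, h'.eq t ht]; ring] at e4
    exact e4)
  have ha := hC a left_mem_uIcc
  have hb := hC b right_mem_uIcc
  simp only [smul_eq_mul, intervalIntegral.integral_same, add_zero, sub_zero, zero_add] at ha hb
  rw [← h.eq b (right_mem_Icc.2 hab), ← h'.eq b (right_mem_Icc.2 hab)] at hb
  linear_combination ha - hb

/-- Green's formula. -/
theorem green (hab : a ≤ b) {u v w z : ℝ → ℂ} (hu : IsPrimitiveOn a b u v)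
    (hv : IsPrimitiveOn a b v f) (hw : IsPrimitiveOn a b w z) (hz : IsPrimitiveOn a b z g) :
    ∫ t in a..b, (u t * g t - f t * w t) =
      (u b * z b - v b * w b) - (u a * z a - v a * w a) := by
  -- Both integrations by parts produce the term `v z`, which cancels in the difference.
  have h1 := integral_mul hab hu hz
  have h2 := integral_mul hab hv hw
  have c : ∀ {P p : ℝ → ℂ}, IsPrimitiveOn a b P p → ContinuousOn P (uIcc a b) := fun hP => by
    rw [uIcc_of_le hab]; exact hP.continuousOn hab
  have i1 : IntervalIntegrable (fun t => u t * g t + v t * z t) volume a b :=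
    (hz.integrable.continuousOn_mul (c hu)).add (hu.integrable.mul_continuousOn (c hz))
  have i2 : IntervalIntegrable (fun t => v t * z t + f t * w t) volume a b :=
    (hw.integrable.continuousOn_mul (c hv)).add (hv.integrable.mul_continuousOn (c hw))
  have h3 := intervalIntegral.integral_sub i1 i2
  rw [h1, h2] at h3
  rw [← sub_eq_zero, ← sub_eq_zero.2 h3]
  have : (fun t => u t * g t - f t * w t) =
      fun t => u t * g t + v t * z t - (v t * z t + f t * w t) := by ext t; ring
  rw [this]
  ring

end IsPrimitiveOn

/-! ### Weak derivatives on a bounded interval -/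

theorem integral_sub_smul {u w : ℝ → ℂ} (hu : Integrable u) (hw : Integrable w) (c : ℝ) :
    ∫ t, (u t - c • w t) = (∫ t, u t) - c • ∫ t, w t := by
  rw [← integral_smul]
  exact integral_sub hu (hw.smul c)

theorem exists_Icc_of_tsupport_subset {a b : ℝ} (hab : a < b) {φ : ℝ → ℝ}
    (hc : HasCompactSupport φ) (hs : tsupport φ ⊆ Ioo a b) :
    ∃ c d, a < c ∧ c ≤ d ∧ d < b ∧ tsupport φ ⊆ Icc c d := by
  rcases (tsupport φ).eq_empty_or_nonempty with h | h
  · exact ⟨(a + b) / 2, (a + b) / 2, by linarith, le_rfl, by linarith, by simp [h]⟩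
  · have hK : IsCompact (tsupport φ) := hc
    have h1 := hs (hK.sInf_mem h)
    have h2 := hs (hK.sSup_mem h)
    exact ⟨_, _, h1.1, csInf_le_csSup h hK.bddBelow hK.bddAbove, h2.2,
      fun t ht => ⟨csInf_le hK.bddBelow ht, le_csSup hK.bddAbove ht⟩⟩

theorem eq_zero_of_notMem_tsupport_subset {φ : ℝ → ℝ} {S : Set ℝ} (h : tsupport φ ⊆ S) {t : ℝ}
    (ht : t ∉ S) : φ t = 0 :=
  image_eq_zero_of_notMem_tsupport fun h' => ht (h h')

/-- A test function with zero mean is the derivative of a test function. -/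
theorem exists_antideriv_testFun {a b : ℝ} (hab : a < b) {φ : ℝ → ℝ} (hφ : ContDiff ℝ ∞ φ)
    (hc : HasCompactSupport φ) (hs : tsupport φ ⊆ Ioo a b) (h0 : ∫ t, φ t = 0) :
    ∃ ψ : ℝ → ℝ, ContDiff ℝ ∞ ψ ∧ HasCompactSupport ψ ∧ tsupport ψ ⊆ Ioo a b ∧ deriv ψ = φ := by
  obtain ⟨c, d, hac, hcd, hdb, hK⟩ := exists_Icc_of_tsupport_subset hab hc hs
  have hd : ∀ t, HasDerivAt (fun t => ∫ s in c..t, φ s) (φ t) t := fun t =>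
    intervalIntegral.integral_hasDerivAt_right (hφ.continuous.intervalIntegrable _ _)
      (hφ.continuous.stronglyMeasurableAtFilter _ _) hφ.continuous.continuousAt
  have hderiv : deriv (fun t => ∫ s in c..t, φ s) = φ := funext fun t => (hd t).deriv
  -- To the left of `c` nothing has been integrated; to the right of `d` the integral is the full
  -- mean, which is zero.
  have hsupp : Function.support (fun t => ∫ s in c..t, φ s) ⊆ Icc c d := by
    intro t ht
    by_contra hn
    refine ht ?_
    simp only [mem_Icc, not_and_or, not_le] at hn
    rcases hn with hn | hn
    · refine intervalIntegral.integral_zero_ae ?_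
      have h1 : ∀ᵐ s ∂(volume : Measure ℝ), s ≠ c := (countable_singleton c).ae_notMem volume
      filter_upwards [h1] with s hsc hst
      rw [uIoc_of_ge hn.le] at hst
      exact eq_zero_of_notMem_tsupport_subset hK fun h => hsc (le_antisymm hst.2 h.1)
    · have h1 : ∫ s in c..t, φ s = ∫ s in c..d, φ s := by
        rw [← intervalIntegral.integral_add_adjacent_intervals
          (hφ.continuous.intervalIntegrable c d) (hφ.continuous.intervalIntegrable d t),
          add_eq_left]
        refine intervalIntegral.integral_zero_ae (.of_forall fun s hst => ?_)
        rw [uIoc_of_le hn.le] at hst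
        exact eq_zero_of_notMem_tsupport_subset hK fun h => absurd h.2 (not_le.2 hst.1)
      show ∫ s in c..t, φ s = 0
      rw [h1, intervalIntegral.integral_of_le hcd, ← integral_Icc_eq_integral_Ioc,
        setIntegral_eq_integral_of_forall_compl_eq_zero
          fun s hst => eq_zero_of_notMem_tsupport_subset hK hst, h0]
  have hts : tsupport (fun t => ∫ s in c..t, φ s) ⊆ Icc c d := closure_minimal hsupp isClosed_Icc
  refine ⟨fun t => ∫ s in c..t, φ s, ?_, ?_, hts.trans (Icc_subset_Ioo hac hdb), hderiv⟩
  · rw [contDiff_infty_iff_deriv, hderiv]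
    exact ⟨fun t => (hd t).differentiableAt, hφ⟩
  · exact isCompact_Icc.of_isClosed_subset (isClosed_tsupport _) hts

/-- Every nonempty open interval carries a test function with integral one. -/
theorem exists_testFun_integral_one {a b : ℝ} (hab : a < b) :
    ∃ φ : ℝ → ℝ, ContDiff ℝ ∞ φ ∧ HasCompactSupport φ ∧ tsupport φ ⊆ Ioo a b ∧
      ∫ t, φ t = 1 := by
  let B : ContDiffBump ((a + b) / 2) := ⟨(b - a) / 8, (b - a) / 4, by linarith, by linarith⟩
  refine ⟨B.normed volume, B.contDiff_normed, B.hasCompactSupport_normed, ?_, B.integral_normed⟩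
  rw [B.tsupport_normed_eq, Real.closedBall_eq_Icc]
  refine Icc_subset_Ioo ?_ ?_ <;> show _ < _ <;> simp only [B] <;> linarith

/-- Subtracting its mean from a test function leaves the derivative of a test function. -/
theorem exists_antideriv_sub_mean {a b : ℝ} (hab : a < b) {φ₀ φ : ℝ → ℝ} (h₀ : ContDiff ℝ ∞ φ₀)
    (hc₀ : HasCompactSupport φ₀) (hs₀ : tsupport φ₀ ⊆ Ioo a b) (hi₀ : ∫ t, φ₀ t = 1)
    (hφ : ContDiff ℝ ∞ φ) (hc : HasCompactSupport φ) (hs : tsupport φ ⊆ Ioo a b) :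
    ∃ ψ : ℝ → ℝ, ContDiff ℝ ∞ ψ ∧ HasCompactSupport ψ ∧ tsupport ψ ⊆ Ioo a b ∧
      deriv ψ = fun t => φ t - (∫ s, φ s) * φ₀ t := by
  have hm : HasCompactSupport fun t => (∫ s, φ s) * φ₀ t := hc₀.mul_left
  refine exists_antideriv_testFun hab (hφ.sub (contDiff_const.mul h₀)) (hc.sub hm) ?_ ?_
  · refine (tsupport_sub φ _).trans (union_subset hs ?_)
    exact Subset.trans (closure_minimal (fun t ht => subset_tsupport φ₀ fun h0 =>
      Function.mem_support.1 ht (by simp [h0])) (isClosed_tsupport _)) hs₀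
  · rw [integral_sub (hφ.continuous.integrable_of_hasCompactSupport hc)
      ((h₀.continuous.integrable_of_hasCompactSupport hc₀).const_mul _), integral_const_mul, hi₀]
    ring

theorem IsWeakDeriv.of_comp {U : Set ℝ} {f v g : ℝ → ℂ} (h : IsWeakDeriv U 1 f v)
    (h' : IsWeakDeriv U 1 v g) : IsWeakDeriv U 2 f g := by
  refine ⟨h.1, h'.2.1, fun φ h1 h2 h3 => ?_⟩
  have e1 := h.2.2 (deriv φ) (contDiff_infty_iff_deriv.1 h1).2 h2.deriv
    ((closure_minimal support_deriv_subset (isClosed_tsupport _)).trans h3)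
  have e2 := h'.2.2 φ h1 h2 h3
  rw [iteratedDeriv_succ', e1, ← iteratedDeriv_one, e2]
  ring

/-- A function with vanishing weak derivative is constant. -/
theorem IsWeakDeriv.exists_const {a b : ℝ} (hab : a < b) {f : ℝ → ℂ}
    (h : IsWeakDeriv (Ioo a b) 1 f 0) : ∃ c : ℂ, f =ᵐ[volume.restrict (Ioo a b)] fun _ => c := by
  obtain ⟨φ₀, h₀, hc₀, hs₀, hi₀⟩ := exists_testFun_integral_one hab
  refine ⟨∫ t, φ₀ t • f t, ?_⟩
  have hconst : LocallyIntegrableOn (fun _ : ℝ => ∫ t, φ₀ t • f t) (Ioo a b) :=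
    (locallyIntegrable_const _).locallyIntegrableOn _
  -- Du Bois-Reymond: `φ - (∫ φ) φ₀` is the derivative of a test function, so `f` annihilates it.
  -- Hence `f` minus its mean against `φ₀` annihilates `φ`.
  have key := isOpen_Ioo.ae_eq_zero_of_integral_contDiff_smul_eq_zero (h.1.sub hconst)
    (μ := volume) (fun φ hφ hc hs => by
    obtain ⟨ψ, k1, k2, k3, k4⟩ := exists_antideriv_sub_mean hab h₀ hc₀ hs₀ hi₀ hφ hc hs
    have e := h.2.2 ψ k1 k2 k3
    rw [iteratedDeriv_one, k4] at e
    have i1 := integrable_testFun_smul h.1 hφ.continuous hc hs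
    have i2 := integrable_testFun_smul h.1 h₀.continuous hc₀ hs₀
    have i3 := integrable_testFun_smul hconst hφ.continuous hc hs
    simp only [sub_smul, mul_smul, Pi.zero_apply, smul_zero, integral_zero, mul_zero] at e
    rw [integral_sub_smul i1 i2] at e
    simp only [Pi.sub_apply, smul_sub]
    rw [integral_sub i1 i3, integral_smul_const, e])
  refine (ae_restrict_iff' measurableSet_Ioo).2 ?_
  filter_upwards [key] with t ht hmem
  exact sub_eq_zero.1 (ht hmem)

theorem IsPrimitiveOn.locallyIntegrableOn {a b : ℝ} (hab : a ≤ b) {F f : ℝ → ℂ}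
    (h : IsPrimitiveOn a b F f) : LocallyIntegrableOn f (Ioo a b) :=
  ((intervalIntegrable_iff_integrableOn_Ioo_of_le hab).1 h.integrable).locallyIntegrableOn

theorem IsPrimitiveOn.locallyIntegrableOn' {a b : ℝ} (hab : a ≤ b) {F f : ℝ → ℂ}
    (h : IsPrimitiveOn a b F f) : LocallyIntegrableOn F (Ioo a b) :=
  ((intervalIntegrable_iff_integrableOn_Ioo_of_le hab).1
    (h.intervalIntegrable hab)).locallyIntegrableOn

theorem IsPrimitiveOn.of_testFun {φ : ℝ → ℝ} (hφ : ContDiff ℝ ∞ φ) (a b : ℝ) :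
    IsPrimitiveOn a b (fun t => (φ t : ℂ)) (fun t => ((deriv φ t : ℝ) : ℂ)) := by
  have h := contDiff_infty_iff_deriv.1 hφ
  exact .of_hasDerivAt (fun t => (h.1 t).hasDerivAt.ofReal_comp)
    (Complex.continuous_ofReal.comp h.2.continuous)

theorem integral_eq_intervalIntegral_of_support {a b : ℝ} (hab : a ≤ b) {h : ℝ → ℂ}
    (hs : ∀ t, t ∉ Ioo a b → h t = 0) : ∫ t, h t = ∫ t in a..b, h t := by
  rw [intervalIntegral.integral_of_le hab, integral_Ioc_eq_integral_Ioo,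
    setIntegral_eq_integral_of_forall_compl_eq_zero hs]

theorem IsPrimitiveOn.isWeakDeriv {a b : ℝ} (hab : a ≤ b) {F f : ℝ → ℂ}
    (h : IsPrimitiveOn a b F f) : IsWeakDeriv (Ioo a b) 1 F f := by
  refine ⟨h.locallyIntegrableOn' hab, h.locallyIntegrableOn hab, fun φ h1 h2 h3 => ?_⟩
  have hφ := IsPrimitiveOn.of_testFun h1 a b
  have hd : tsupport (deriv φ) ⊆ Ioo a b :=
    (closure_minimal support_deriv_subset (isClosed_tsupport _)).trans h3
  have z : ∀ t, t ∉ Ioo a b → φ t = 0 := fun t ht => eq_zero_of_notMem_tsupport_subset h3 ht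
  have zd : ∀ t, t ∉ Ioo a b → deriv φ t = 0 :=
    fun t ht => eq_zero_of_notMem_tsupport_subset hd ht
  have hc : ∀ {P p : ℝ → ℂ}, IsPrimitiveOn a b P p → ContinuousOn P (uIcc a b) := fun hP => by
    rw [uIcc_of_le hab]; exact hP.continuousOn hab
  have e := hφ.integral_mul hab h
  rw [z a (by simp), z b (by simp), intervalIntegral.integral_add
    (h.integrable.continuousOn_mul (hc hφ)) (hφ.integrable.mul_continuousOn (hc h))] at e
  rw [iteratedDeriv_one, integral_eq_intervalIntegral_of_support hab fun t ht => by simp [zd t ht],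
    integral_eq_intervalIntegral_of_support hab fun t ht => by simp [z t ht]]
  simp only [Complex.real_smul, pow_one]
  rw [Complex.ofReal_zero] at e
  linear_combination e

/-- A function with an integrable weak derivative is a.e. equal to a primitive. -/
theorem IsWeakDeriv.exists_isPrimitiveOn {a b : ℝ} (hab : a < b) {f g : ℝ → ℂ}
    (h : IsWeakDeriv (Ioo a b) 1 f g) (hg : IntervalIntegrable g volume a b) :
    ∃ F, IsPrimitiveOn a b F g ∧ f =ᵐ[volume.restrict (Ioo a b)] F := by
  have h1 := (IsPrimitiveOn.of_integrable hg 0).isWeakDeriv hab.le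
  -- Subtracting one primitive of `g` leaves a function with weak derivative zero.
  have h2 := h.add (h1.smul (-1))
  rw [show g + (-1 : ℂ) • g = 0 by ext t; simp] at h2
  obtain ⟨c, hc⟩ := h2.exists_const hab
  refine ⟨_, IsPrimitiveOn.of_integrable hg c, ?_⟩
  filter_upwards [hc] with t ht
  simp only [Pi.add_apply, Pi.smul_apply, smul_eq_mul] at ht
  linear_combination ht

/-- A function with an integrable second weak derivative has a first one. -/
theorem IsWeakDeriv.exists_first {a b : ℝ} (hab : a < b) {f g : ℝ → ℂ}
    (h : IsWeakDeriv (Ioo a b) 2 f g) (hg : IntervalIntegrable g volume a b) :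
    ∃ v, IsPrimitiveOn a b v g ∧ IsWeakDeriv (Ioo a b) 1 f v := by
  obtain ⟨φ₀, h₀, hc₀, hs₀, hi₀⟩ := exists_testFun_integral_one hab
  have hG := IsPrimitiveOn.of_integrable hg 0
  set G : ℝ → ℂ := fun t => 0 + ∫ s in a..t, g s
  have hd₀ : tsupport (deriv φ₀) ⊆ Ioo a b :=
    (closure_minimal support_deriv_subset (isClosed_tsupport _)).trans hs₀
  -- The constant of integration is forced by testing with `φ₀`: `∫ φ₀ v = -∫ φ₀' f`, where `∫ φ₀ =
  -- 1`.
  have hv := IsPrimitiveOn.of_integrable hg (-((∫ t, deriv φ₀ t • f t) + ∫ t, φ₀ t • G t))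
  have hvG : ∀ t, -((∫ t, deriv φ₀ t • f t) + ∫ t, φ₀ t • G t) + ∫ s in a..t, g s =
      -((∫ t, deriv φ₀ t • f t) + ∫ t, φ₀ t • G t) + G t := fun t => by simp [G]
  refine ⟨_, hv, h.1, hv.locallyIntegrableOn' hab.le, fun φ hφ hc hs => ?_⟩
  -- Split `φ = ψ' + (∫ φ) φ₀`. For `ψ'` the claim follows from the second derivative of `f` and the
  -- first of `G`, for `φ₀` from the choice of the constant.
  obtain ⟨ψ, k1, k2, k3, k4⟩ := exists_antideriv_sub_mean hab h₀ hc₀ hs₀ hi₀ hφ hc hs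
  have e1 := h.2.2 ψ k1 k2 k3
  have e2 := (hG.isWeakDeriv hab.le).2.2 ψ k1 k2 k3
  have hd : tsupport (deriv φ) ⊆ Ioo a b :=
    (closure_minimal support_deriv_subset (isClosed_tsupport _)).trans hs
  have c1 := contDiff_infty_iff_deriv.1 hφ
  have c2 := contDiff_infty_iff_deriv.1 h₀
  have hdd : deriv (deriv ψ) = fun t => deriv φ t - (∫ s, φ s) * deriv φ₀ t := by
    rw [k4]
    ext t
    exact ((c1.1 t).hasDerivAt.sub ((c2.1 t).hasDerivAt.const_mul _)).deriv
  rw [iteratedDeriv_succ', iteratedDeriv_one, hdd] at e1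
  rw [iteratedDeriv_one, k4] at e2
  have j1 := integrable_testFun_smul h.1 c1.2.continuous hc.deriv hd
  have j2 := integrable_testFun_smul h.1 c2.2.continuous hc₀.deriv hd₀
  have lG := hG.locallyIntegrableOn' hab.le
  have j3 := integrable_testFun_smul lG hφ.continuous hc hs
  have j4 := integrable_testFun_smul lG h₀.continuous hc₀ hs₀
  have j5 : Integrable fun t => φ t • (-((∫ t, deriv φ₀ t • f t) + ∫ t, φ₀ t • G t)) :=
    (hφ.continuous.integrable_of_hasCompactSupport hc).smul_const _
  simp only [sub_smul, mul_smul] at e1 e2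
  rw [integral_sub_smul j1 j2] at e1
  rw [integral_sub_smul j3 j4] at e2
  rw [iteratedDeriv_one]
  simp only [hvG, smul_add]
  rw [integral_add j5 j3, integral_smul_const]
  simp only [Complex.real_smul] at e1 e2 ⊢
  linear_combination e1 + e2

/-! ### One-sided values -/

/-- A one-sided neighbourhood has positive measure, so it meets every set of full measure. This
makes one-sided values up to null sets unique. -/
theorem neBot_nhdsGT_inf_ae (a : ℝ) : (𝓝[>] a ⊓ ae (volume : Measure ℝ)).NeBot := by
  refine inf_neBot_iff.2 fun {s} hs {t} ht => ?_
  obtain ⟨c, hc, hcs⟩ := mem_nhdsGT_iff_exists_Ioo_subset.1 hs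
  by_contra hn
  have h1 : Ioo a c ⊆ tᶜ := fun r hr hrt => hn ⟨r, hcs hr, hrt⟩
  have h2 : volume (Ioo a c) = 0 := measure_mono_null h1 ht
  rw [Real.volume_Ioo, ENNReal.ofReal_eq_zero] at h2
  linarith [mem_Ioi.1 hc]

theorem neBot_nhdsLT_inf_ae (a : ℝ) : (𝓝[<] a ⊓ ae (volume : Measure ℝ)).NeBot := by
  refine inf_neBot_iff.2 fun {s} hs {t} ht => ?_
  obtain ⟨c, hc, hcs⟩ := mem_nhdsLT_iff_exists_Ioo_subset.1 hs
  by_contra hn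
  have h1 : Ioo c a ⊆ tᶜ := fun r hr hrt => hn ⟨r, hcs hr, hrt⟩
  have h2 : volume (Ioo c a) = 0 := measure_mono_null h1 ht
  rw [Real.volume_Ioo, ENNReal.ofReal_eq_zero] at h2
  linarith [mem_Iio.1 hc]

theorem RightValue.unique {f : ℝ → ℂ} {a : ℝ} {c d : ℂ} (h : RightValue f a c)
    (h' : RightValue f a d) : c = d := by
  have := neBot_nhdsGT_inf_ae a
  exact tendsto_nhds_unique h h'

theorem LeftValue.unique {f : ℝ → ℂ} {a : ℝ} {c d : ℂ} (h : LeftValue f a c)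
    (h' : LeftValue f a d) : c = d := by
  have := neBot_nhdsLT_inf_ae a
  exact tendsto_nhds_unique h h'

theorem rightValue_of_ae_eq {a b : ℝ} (hab : a < b) {f F : ℝ → ℂ} (hF : ContinuousOn F (Icc a b))
    (h : f =ᵐ[volume.restrict (Ioo a b)] F) : RightValue f a (F a) := by
  have h1 : Tendsto F (𝓝[>] a ⊓ ae volume) (𝓝 (F a)) :=
    (((hF a (left_mem_Icc.2 hab.le)).mono_of_mem_nhdsWithin
      (mem_of_superset (Ioo_mem_nhdsGT hab) Ioo_subset_Icc_self)).tendsto).mono_left inf_le_left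
  refine h1.congr' ?_
  have h2 : ∀ᶠ t in 𝓝[>] a ⊓ ae (volume : Measure ℝ), t ∈ Ioo a b → f t = F t :=
    ((ae_restrict_iff' measurableSet_Ioo).1 h).filter_mono inf_le_right
  have h3 : ∀ᶠ t in 𝓝[>] a ⊓ ae (volume : Measure ℝ), t ∈ Ioo a b :=
    Filter.Eventually.filter_mono inf_le_left (Ioo_mem_nhdsGT hab)
  filter_upwards [h2, h3] with t k1 k2 using (k1 k2).symm

theorem leftValue_of_ae_eq {a b : ℝ} (hab : a < b) {f F : ℝ → ℂ} (hF : ContinuousOn F (Icc a b))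
    (h : f =ᵐ[volume.restrict (Ioo a b)] F) : LeftValue f b (F b) := by
  have h1 : Tendsto F (𝓝[<] b ⊓ ae volume) (𝓝 (F b)) :=
    (((hF b (right_mem_Icc.2 hab.le)).mono_of_mem_nhdsWithin
      (mem_of_superset (Ioo_mem_nhdsLT hab) Ioo_subset_Icc_self)).tendsto).mono_left inf_le_left
  refine h1.congr' ?_
  have h2 : ∀ᶠ t in 𝓝[<] b ⊓ ae (volume : Measure ℝ), t ∈ Ioo a b → f t = F t :=
    ((ae_restrict_iff' measurableSet_Ioo).1 h).filter_mono inf_le_right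
  have h3 : ∀ᶠ t in 𝓝[<] b ⊓ ae (volume : Measure ℝ), t ∈ Ioo a b :=
    Filter.Eventually.filter_mono inf_le_left (Ioo_mem_nhdsLT hab)
  filter_upwards [h2, h3] with t k1 k2 using (k1 k2).symm

/-! ### Integrability on bounded intervals -/

theorem memLp_of_continuousOn_Icc {a b : ℝ} {F : ℝ → ℂ} (hF : ContinuousOn F (Icc a b))
    (p : ℝ≥0∞) : MemLp F p (volume.restrict (Ioo a b)) := by
  obtain ⟨C, hC⟩ := isCompact_Icc.exists_bound_of_continuousOn hF
  refine MemLp.of_bound ((hF.mono Ioo_subset_Icc_self).aestronglyMeasurable measurableSet_Ioo) C ?_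
  exact (ae_restrict_iff' measurableSet_Ioo).2
    (.of_forall fun t ht => hC t (Ioo_subset_Icc_self ht))

theorem intervalIntegrable_of_memLp {a b : ℝ} (hab : a ≤ b) {f : ℝ → ℂ} {p : ℝ≥0∞} (hp : 1 ≤ p)
    (h : MemLp f p (volume.restrict (Ioo a b))) : IntervalIntegrable f volume a b :=
  (intervalIntegrable_iff_integrableOn_Ioo_of_le hab).2 (h.integrable hp)

/-! ### Gluing functions on the intervals between consecutive centres -/

theorem Centers.lt_succ (X : Centers) (k : ℕ) : X.x k < X.x (k + 1) := X.strictMono k.lt_succ_self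

theorem Centers.eq_of_mem_Ioo (X : Centers) {j k : ℕ} {t : ℝ}
    (hj : t ∈ Ioo (X.x j) (X.x (j + 1))) (hk : t ∈ Ioo (X.x k) (X.x (k + 1))) : j = k := by
  have h1 := X.strictMono.lt_iff_lt.1 (hj.1.trans hk.2)
  have h2 := X.strictMono.lt_iff_lt.1 (hk.1.trans hj.2)
  omega

/-- The function that equals `w k` on the interval `(x_k, x_{k+1})`. -/
def glue (X : Centers) (w : ℕ → ℝ → ℂ) (t : ℝ) : ℂ :=
  ∑' k, (Ioo (X.x k) (X.x (k + 1))).indicator (w k) t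

theorem glue_of_mem (X : Centers) (w : ℕ → ℝ → ℂ) {k : ℕ} {t : ℝ}
    (ht : t ∈ Ioo (X.x k) (X.x (k + 1))) : glue X w t = w k t := by
  rw [glue, tsum_eq_single k, indicator_of_mem ht]
  intro j hj
  exact indicator_of_notMem (fun h => hj (X.eq_of_mem_Ioo h ht)) _

theorem glue_ae_eq (X : Centers) (w : ℕ → ℝ → ℂ) (k : ℕ) :
    glue X w =ᵐ[volume.restrict (Ioo (X.x k) (X.x (k + 1)))] w k :=
  (ae_restrict_iff' measurableSet_Ioo).2 (.of_forall fun _ ht => glue_of_mem X w ht)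

theorem memLp_glue (X : Centers) {w : ℕ → ℝ → ℂ} {N : ℕ} (hN : ∀ k, N ≤ k → w k = 0)
    (hw : ∀ k, Continuous (w k)) (p : ℝ≥0∞) : MemLp (glue X w) p halfLine := by
  have h1 : MemLp (∑ k ∈ Finset.range N, (Ioo (X.x k) (X.x (k + 1))).indicator (w k)) p
      halfLine := memLp_finsetSum' _ fun k _ => by
    rw [memLp_indicator_iff_restrict measurableSet_Ioo]
    rw [Measure.restrict_restrict measurableSet_Ioo, inter_eq_left.2 (X.Ioo_subset k)]
    exact memLp_of_continuousOn_Icc (hw k).continuousOn p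
  refine h1.ae_eq (X.ae_of_forall_Ioo fun k => ?_)
  refine (ae_restrict_iff' measurableSet_Ioo).2 (.of_forall fun t ht => ?_)
  rw [glue_of_mem X w ht, Finset.sum_apply]
  have h0 : ∀ j, j ≠ k → (Ioo (X.x j) (X.x (j + 1))).indicator (w j) t = 0 := fun j hj =>
    indicator_of_notMem (fun h => hj (X.eq_of_mem_Ioo h ht)) _
  by_cases hk : k < N
  · rw [Finset.sum_eq_single_of_mem k (Finset.mem_range.2 hk) fun j _ hj => h0 j hj,
      indicator_of_mem ht]
  · rw [hN k (not_lt.1 hk)]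
    exact Finset.sum_eq_zero fun j hj => h0 j fun e => hk (e ▸ Finset.mem_range.1 hj)

theorem hasBoundedSupport_glue (X : Centers) {w : ℕ → ℝ → ℂ} {N : ℕ}
    (hN : ∀ k, N ≤ k → w k = 0) : HasBoundedSupport (glue X w) := by
  refine ⟨X.x N, X.ae_of_forall_Ioo fun k => ?_⟩
  refine (ae_restrict_iff' measurableSet_Ioo).2 (.of_forall fun t ht hNt => ?_)
  have : N ≤ k := Nat.lt_succ_iff.1 (X.strictMono.lt_iff_lt.1 (hNt.trans ht.2))
  rw [glue_of_mem X w ht, hN k this]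
  rfl

/-! ### Functions with two piecewise derivatives -/

/-- On each interval `(x_k, x_{k+1})` the function `f` equals `u k`, with first derivative `v k` and
second derivative `f''`. -/
structure HasPieces (X : Centers) (f f'' : ℝ → ℂ) (u v : ℕ → ℝ → ℂ) : Prop where
  ae_eq : ∀ k, f =ᵐ[volume.restrict (Ioo (X.x k) (X.x (k + 1)))] u k
  fst : ∀ k, IsPrimitiveOn (X.x k) (X.x (k + 1)) (u k) (v k)
  snd : ∀ k, IsPrimitiveOn (X.x k) (X.x (k + 1)) (v k) f''

/-- The boundary condition at `0` and the interface conditions at the centres. -/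
structure Matches (X : Centers) (α : ℕ → ℝ) (u v : ℕ → ℝ → ℂ) : Prop where
  zero : u 0 0 = 0
  value : ∀ k, u k (X.x (k + 1)) = u (k + 1) (X.x (k + 1))
  jump : ∀ k, v (k + 1) (X.x (k + 1)) - v k (X.x (k + 1)) = α (k + 1) * u k (X.x (k + 1))

/-- Conjugation preserves the interface conditions because each `α k` is real. It is needed because
the inner product conjugates its first argument. -/
theorem Matches.conj {X : Centers} {α : ℕ → ℝ} {u v : ℕ → ℝ → ℂ} (h : Matches X α u v) :
    Matches X α (fun k t => starRingEnd ℂ (u k t)) fun k t => starRingEnd ℂ (v k t) :=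
  ⟨by simp [h.zero], fun k => by simp [h.value k], fun k => by
    rw [← map_sub, h.jump k, map_mul, Complex.conj_ofReal]⟩

theorem IsPiecewiseDeriv.exists_hasPieces {X : Centers} {f g : ℝ → ℂ}
    (h : IsPiecewiseDeriv X.x 2 f g)
    (hg : ∀ k, IntervalIntegrable g volume (X.x k) (X.x (k + 1))) :
    ∃ u v, HasPieces X f g u v := by
  choose v hv hfv using fun k => (h k).exists_first (X.lt_succ k) (hg k)
  choose u hu hfu using fun k =>
    (hfv k).exists_isPrimitiveOn (X.lt_succ k) ((hv k).intervalIntegrable (X.lt_succ k).le)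
  exact ⟨u, v, hfu, hu, hv⟩

namespace HasPieces

variable {X : Centers} {α : ℕ → ℝ} {f f'' : ℝ → ℂ} {u v : ℕ → ℝ → ℂ}

theorem isWeakDeriv_one (h : HasPieces X f f'' u v) (k : ℕ) :
    IsWeakDeriv (Ioo (X.x k) (X.x (k + 1))) 1 f (v k) :=
  ((h.fst k).isWeakDeriv (X.lt_succ k).le).congr measurableSet_Ioo (h.ae_eq k).symm .rfl

theorem isPiecewiseDeriv_two (h : HasPieces X f f'' u v) : IsPiecewiseDeriv X.x 2 f f'' :=
  fun k => (h.isWeakDeriv_one k).of_comp ((h.snd k).isWeakDeriv (X.lt_succ k).le)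

theorem rightValue (h : HasPieces X f f'' u v) (k : ℕ) :
    RightValue f (X.x k) (u k (X.x k)) :=
  rightValue_of_ae_eq (X.lt_succ k) ((h.fst k).continuousOn (X.lt_succ k).le) (h.ae_eq k)

theorem leftValue (h : HasPieces X f f'' u v) (k : ℕ) :
    LeftValue f (X.x (k + 1)) (u k (X.x (k + 1))) :=
  leftValue_of_ae_eq (X.lt_succ k) ((h.fst k).continuousOn (X.lt_succ k).le) (h.ae_eq k)

theorem deriv_ae_eq (h : HasPieces X f f'' u v) {f' : ℝ → ℂ} (hf' : IsPiecewiseDeriv X.x 1 f f')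
    (k : ℕ) : f' =ᵐ[volume.restrict (Ioo (X.x k) (X.x (k + 1)))] v k :=
  (hf' k).unique isOpen_Ioo (h.isWeakDeriv_one k)

theorem isPiecewiseDeriv_one (h : HasPieces X f f'' u v) :
    IsPiecewiseDeriv X.x 1 f (glue X v) :=
  fun k => (h.isWeakDeriv_one k).congr measurableSet_Ioo .rfl (glue_ae_eq X v k).symm

theorem rightValue_deriv (h : HasPieces X f f'' u v) {f' : ℝ → ℂ}
    (hf' : IsPiecewiseDeriv X.x 1 f f') (k : ℕ) : RightValue f' (X.x k) (v k (X.x k)) :=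
  rightValue_of_ae_eq (X.lt_succ k) ((h.snd k).continuousOn (X.lt_succ k).le) (h.deriv_ae_eq hf' k)

theorem leftValue_deriv (h : HasPieces X f f'' u v) {f' : ℝ → ℂ}
    (hf' : IsPiecewiseDeriv X.x 1 f f') (k : ℕ) :
    LeftValue f' (X.x (k + 1)) (v k (X.x (k + 1))) :=
  leftValue_of_ae_eq (X.lt_succ k) ((h.snd k).continuousOn (X.lt_succ k).le) (h.deriv_ae_eq hf' k)

/-- On each interval `f` and `f'` have the continuous representatives `u k` and `v k`, and one-sided
values are unique, so the limits in (∗) are end point values. -/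
theorem deltaConditions_iff (h : HasPieces X f f'' u v) :
    DeltaConditions X.x α f ↔ Matches X α u v := by
  have h0 : RightValue f 0 (u 0 0) := by simpa only [X.x_zero] using h.rightValue 0
  constructor
  · rintro ⟨a1, f', a2, a3⟩
    have key : ∀ k, u k (X.x (k + 1)) = u (k + 1) (X.x (k + 1)) ∧
        v (k + 1) (X.x (k + 1)) - v k (X.x (k + 1)) = α (k + 1) * u k (X.x (k + 1)) := by
      intro k
      -- The centre `x (k + 1)` has piece `k` on its left and piece `k + 1` on its right.
      obtain ⟨c, a, b, h1, h2, h3, h4, h5⟩ := a3 (k + 1) (Nat.le_add_left 1 k)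
      rw [(h.leftValue k).unique h1, (h.rightValue (k + 1)).unique h2,
        (h.leftValue_deriv a2 k).unique h3, (h.rightValue_deriv a2 (k + 1)).unique h4]
      exact ⟨rfl, h5⟩
    exact ⟨h0.unique a1, fun k => (key k).1, fun k => (key k).2⟩
  · rintro ⟨b1, b2, b3⟩
    refine ⟨by rwa [b1] at h0, glue X v, h.isPiecewiseDeriv_one, fun k hk => ?_⟩
    obtain ⟨j, rfl⟩ := Nat.exists_eq_add_of_le' hk
    exact ⟨_, _, _, h.leftValue j, by rw [b2 j]; exact h.rightValue (j + 1),
      h.leftValue_deriv h.isPiecewiseDeriv_one j,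
      h.rightValue_deriv h.isPiecewiseDeriv_one (j + 1), b3 j⟩

/-- The first derivative is continuous on each closed bounded interval and so lies there in every
`L^p`; only `f` and `f''` need an assumption. -/
theorem memPiecewiseSobolev (h : HasPieces X f f'' u v) {p : ℝ≥0∞} (hf : MemLp f p halfLine)
    (hf'' : MemLp f'' p halfLine) : MemPiecewiseSobolev X.x 2 p f := by
  have hr : ∀ {g : ℝ → ℂ} (k : ℕ), MemLp g p halfLine →
      MemLp g p (volume.restrict (Ioo (X.x k) (X.x (k + 1)))) := fun k hg =>
    hg.mono_measure (Measure.restrict_mono (X.Ioo_subset k) le_rfl)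
  refine ⟨hf, fun k i hi => ?_, f'', h.isPiecewiseDeriv_two, hf''⟩
  interval_cases i
  · refine ⟨f, ⟨(h.isWeakDeriv_one k).1, (h.isWeakDeriv_one k).1, fun φ _ _ _ => by simp⟩, hr k hf⟩
  · exact ⟨v k, h.isWeakDeriv_one k,
      memLp_of_continuousOn_Icc ((h.snd k).continuousOn (X.lt_succ k).le) p⟩
  · exact ⟨f'', h.isPiecewiseDeriv_two k, hr k hf''⟩

end HasPieces

/-! ### Green's formula on the half-line -/

theorem IsPrimitiveOn.congr_right {a b : ℝ} {F f g : ℝ → ℂ} (h : IsPrimitiveOn a b F f)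
    (hab : a ≤ b) (e : f =ᵐ[volume.restrict (Ioo a b)] g) : IsPrimitiveOn a b F g := by
  have e' : ∀ᵐ s ∂(volume : Measure ℝ), s ∈ Ioc a b → f s = g s := by
    have h1 : ∀ᵐ s ∂(volume : Measure ℝ), s ≠ b := (countable_singleton b).ae_notMem volume
    filter_upwards [(ae_restrict_iff' measurableSet_Ioo).1 e, h1] with s k1 k2 k3
    exact k1 ⟨k3.1, lt_of_le_of_ne k3.2 k2⟩
  refine ⟨h.integrable.congr_ae ?_, fun t ht => ?_⟩
  · rw [uIoc_of_le hab]
    exact (ae_restrict_iff' measurableSet_Ioc).2 e'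
  · rw [h.eq t ht]
    congr 1
    refine intervalIntegral.integral_congr_ae ?_
    filter_upwards [e'] with s k1 k2
    rw [uIoc_of_le ht.1] at k2
    exact k1 ⟨k2.1, k2.2.trans ht.2⟩

/-- The integral of a function on the half-line that vanishes beyond the centre `x N`. -/
theorem integral_halfLine_eq_sum (X : Centers) {Φ : ℝ → ℂ} (hΦ : Integrable Φ halfLine) {N : ℕ}
    (hN : ∀ᵐ t ∂halfLine, X.x N < t → Φ t = 0) :
    ∫ t, Φ t ∂halfLine = ∑ k ∈ Finset.range N, ∫ t in X.x k..X.x (k + 1), Φ t := by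
  have hint : ∀ a b, 0 ≤ a → a ≤ b → IntervalIntegrable Φ volume a b := fun a b ha hab =>
    (intervalIntegrable_iff_integrableOn_Ioc_of_le hab).2
      (IntegrableOn.mono_set hΦ fun t ht => ha.trans ht.1.le)
  rw [intervalIntegral.sum_integral_adjacent_intervals fun k _ =>
    hint _ _ (X.nonneg k) (X.lt_succ k).le, X.x_zero,
    intervalIntegral.integral_of_le (X.nonneg N), ← integral_Icc_eq_integral_Ioc]
  refine (setIntegral_eq_of_subset_of_ae_sdiff_eq_zero measurableSet_Ici.nullMeasurableSet
    Icc_subset_Ici_self ?_)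
  filter_upwards [(ae_restrict_iff' measurableSet_Ici).1 hN] with t h1 h2
  exact h1 h2.1 (not_le.1 fun h => h2.2 ⟨h2.1, h⟩)

/-- The terms with `q` cancel because `q` is real; the rest is Green's formula for `conj f` and `g`
on each interval. The sum is finite as soon as one of the two functions, here `g`, has bounded
support. -/
theorem inner_sub_inner_eq_sum {X : Centers} {q : ℝ → ℝ} {f h g k : L2Half} {f₂ g₂ : ℝ → ℂ}
    {u v w z : ℕ → ℝ → ℂ} (hf : HasPieces X f f₂ u v)
    (hh : h =ᵐ[halfLine] fun t => -f₂ t + q t * f t) (hg : HasPieces X g g₂ w z)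
    (hk : k =ᵐ[halfLine] fun t => -g₂ t + q t * g t) {N : ℕ}
    (hN : ∀ᵐ t ∂halfLine, X.x N < t → g t = 0) :
    inner ℂ h g - inner ℂ f k = ∑ j ∈ Finset.range N,
      ((starRingEnd ℂ (u j (X.x (j + 1))) * z j (X.x (j + 1)) -
          starRingEnd ℂ (v j (X.x (j + 1))) * w j (X.x (j + 1))) -
        (starRingEnd ℂ (u j (X.x j)) * z j (X.x j) -
          starRingEnd ℂ (v j (X.x j)) * w j (X.x j))) := by
  -- Where `g` vanishes on a whole interval, uniqueness of weak derivatives makes `g₂` vanish too.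
  have hg₂ : ∀ᵐ t ∂halfLine, X.x N < t → g₂ t = 0 := X.ae_of_forall_Ioo fun j => by
    by_cases hj : N ≤ j
    · have h0 : (g : ℝ → ℂ) =ᵐ[volume.restrict (Ioo (X.x j) (X.x (j + 1)))] 0 := by
        filter_upwards [ae_restrict_of_ae_restrict_of_subset (X.Ioo_subset j) hN,
          ae_restrict_mem measurableSet_Ioo] with t h1 h2
        exact h1 ((X.strictMono.monotone hj).trans_lt h2.1)
      have h1 := ((hg.isPiecewiseDeriv_two j).congr measurableSet_Ioo h0 .rfl).unique isOpen_Ioo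
        (IsWeakDeriv.zero _ 2)
      filter_upwards [h1] with t ht _ using ht
    · filter_upwards [ae_restrict_mem measurableSet_Ioo] with t h2 h3
      exact absurd (h3.trans h2.2) (not_lt.2 (X.strictMono.monotone (by omega)))
  have i1 := L2.integrable_inner (𝕜 := ℂ) h g
  have i2 := L2.integrable_inner (𝕜 := ℂ) f k
  rw [L2.inner_def, L2.inner_def, ← integral_sub i1 i2,
    integral_halfLine_eq_sum X (Φ := fun t => inner ℂ (h t) (g t) - inner ℂ (f t) (k t))
      (i1.sub i2) (N := N)]
  · refine Finset.sum_congr rfl fun j _ => ?_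
    have hle := (X.lt_succ j).le
    rw [← IsPrimitiveOn.green hle (hf.fst j).conj (hf.snd j).conj (hg.fst j) (hg.snd j)]
    refine intervalIntegral.integral_congr_ae ?_
    have hb : ∀ᵐ s ∂(volume : Measure ℝ), s ≠ X.x (j + 1) :=
      (countable_singleton (X.x (j + 1))).ae_notMem volume
    filter_upwards [(ae_restrict_iff' measurableSet_Ioo).1 (hf.ae_eq j),
      (ae_restrict_iff' measurableSet_Ioo).1 (hg.ae_eq j),
      (ae_restrict_iff' measurableSet_Ici).1 hh, (ae_restrict_iff' measurableSet_Ici).1 hk, hb]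
      with t e1 e2 e3 e4 e5 ht
    rw [uIoc_of_le hle] at ht
    have hm : t ∈ Ioo (X.x j) (X.x (j + 1)) := ⟨ht.1, lt_of_le_of_ne ht.2 e5⟩
    have h0 := X.Ioo_subset j hm
    simp only [RCLike.inner_apply]
    rw [e3 h0, e4 h0, ← e1 hm, ← e2 hm]
    simp only [map_add, map_neg, map_mul, Complex.conj_ofReal]
    ring
  · filter_upwards [hN, hg₂, hk] with t e1 e2 e3 ht
    simp only [RCLike.inner_apply]
    rw [e3, e1 ht, e2 ht]
    simp

/-- Since `q` is bounded, `f'' = q f - h` is in `L²` and thus integrable on every bounded interval.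
-/
theorem IsTau.exists_hasPieces {X : Centers} {q : ℝ → ℝ} (hq : MemLp q ∞ halfLine)
    {f h : ℝ → ℂ} (hf : MemLp f 2 halfLine) (hh : MemLp h 2 halfLine) (ht : IsTau X.x q f h) :
    ∃ f₂ u v, HasPieces X f f₂ u v ∧ MemLp f₂ 2 halfLine ∧
      h =ᵐ[halfLine] fun t => -f₂ t + q t * f t := by
  obtain ⟨f₂, h1, h2⟩ := ht
  have hqf : MemLp (fun t => (q t : ℂ) * f t) 2 halfLine := hf.mul hq.ofReal
  have h3 : MemLp f₂ 2 halfLine := (hqf.sub hh).ae_eq (by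
    filter_upwards [h2] with t ht
    simp only [Pi.sub_apply, ht]
    ring)
  obtain ⟨u, v, huv⟩ := h1.exists_hasPieces fun k =>
    intervalIntegrable_of_memLp (X.lt_succ k).le one_le_two
      (h3.mono_measure (Measure.restrict_mono (X.Ioo_subset k) le_rfl))
  exact ⟨f₂, u, v, huv, h3, h2⟩

/-- The boundary form is continuous across every centre, so the boundary terms telescope. At `0`
both functions vanish, and at `x N` both `g` and `g'` do. As `f` may have unbounded support, this
gives one inclusion for the adjoint as well as symmetry. -/
theorem inner_eq_of_isTau {X : Centers} {α : ℕ → ℝ} {q : ℝ → ℝ} (hq : MemLp q ∞ halfLine)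
    {f h g k : L2Half} (hf : IsTau X.x q f h) (hfδ : DeltaConditions X.x α f)
    (hg : (g, k) ∈ preHamiltonianGraph X α q) : inner ℂ h g = inner ℂ f k := by
  obtain ⟨⟨-, R, hR⟩, hgδ, hgτ⟩ := hg
  obtain ⟨f₂, u, v, hfp, -, hh⟩ := hf.exists_hasPieces hq (Lp.memLp f) (Lp.memLp h)
  obtain ⟨g₂, w, z, hgp, -, hk⟩ := hgτ.exists_hasPieces hq (Lp.memLp g) (Lp.memLp k)
  obtain ⟨N, hN⟩ := (X.tendsto.eventually_gt_atTop R).exists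
  have hfm := hfp.deltaConditions_iff.1 hfδ
  have hgm := hgp.deltaConditions_iff.1 hgδ
  have h0 : ∀ᵐ t ∂halfLine, X.x N < t → g t = 0 := by
    filter_upwards [hR] with t h1 h2 using h1 (hN.trans h2)
  have h0N : (g : ℝ → ℂ) =ᵐ[volume.restrict (Ioo (X.x N) (X.x (N + 1)))] fun _ => 0 := by
    filter_upwards [ae_restrict_of_ae_restrict_of_subset (X.Ioo_subset N) h0,
      ae_restrict_mem measurableSet_Ioo] with t h1 h2 using h1 h2.1
  have hw : w N (X.x N) = 0 := (hgp.rightValue N).unique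
    (rightValue_of_ae_eq (X.lt_succ N) continuousOn_const h0N)
  have hz : z N (X.x N) = 0 := by
    have h1 := ((hgp.isWeakDeriv_one N).congr measurableSet_Ioo h0N .rfl).unique isOpen_Ioo
      (IsWeakDeriv.zero _ 1)
    exact (rightValue_of_ae_eq (X.lt_succ N) ((hgp.snd N).continuousOn (X.lt_succ N).le)
      h1.symm).unique (rightValue_of_ae_eq (X.lt_succ N)
        (continuousOn_const (c := (0 : ℂ))) .rfl)
  rw [← sub_eq_zero, inner_sub_inner_eq_sum hfp hh hgp hk h0]
  -- The jumps contribute `α conj(f) g` to both products, and these contributions cancel.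
  have hstep : ∀ j, starRingEnd ℂ (u j (X.x (j + 1))) * z j (X.x (j + 1)) -
      starRingEnd ℂ (v j (X.x (j + 1))) * w j (X.x (j + 1)) =
      starRingEnd ℂ (u (j + 1) (X.x (j + 1))) * z (j + 1) (X.x (j + 1)) -
      starRingEnd ℂ (v (j + 1) (X.x (j + 1))) * w (j + 1) (X.x (j + 1)) := fun j => by
    have a1 := hfm.conj.jump j
    have a2 := hgm.jump j
    rw [← hfm.value j, ← hgm.value j]
    linear_combination w j (X.x (j + 1)) * a1 - starRingEnd ℂ (u j (X.x (j + 1))) * a2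
  simp only [hstep]
  rw [Finset.sum_range_sub fun j => starRingEnd ℂ (u j (X.x j)) * z j (X.x j) -
    starRingEnd ℂ (v j (X.x j)) * w j (X.x j), hw, hz, X.x_zero, hfm.zero, hgm.zero]
  simp

/-! ### Test functions in the domain -/

theorem glue_single (X : Centers) {w : ℕ → ℝ → ℂ} {j : ℕ} (h : ∀ k, k ≠ j → w k = 0) :
    glue X w = (Ioo (X.x j) (X.x (j + 1))).indicator (w j) := by
  ext t
  rw [glue, tsum_eq_single j]
  intro k hk
  rw [h k hk]
  simp

theorem hasPieces_glue (X : Centers) {η : ℕ → ℝ → ℝ} (hη : ∀ k, ContDiff ℝ ∞ (η k)) :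
    HasPieces X (glue X fun k t => (η k t : ℂ)) (glue X fun k t => (deriv (deriv (η k)) t : ℝ))
      (fun k t => (η k t : ℂ)) (fun k t => (deriv (η k) t : ℝ)) :=
  ⟨fun k => glue_ae_eq X _ k, fun k => .of_testFun (hη k) _ _, fun k =>
    (IsPrimitiveOn.of_testFun (contDiff_infty_iff_deriv.1 (hη k)).2 _ _).congr_right
      (X.lt_succ k).le
        (glue_ae_eq X (fun k t => ((deriv (deriv (η k)) t : ℝ) : ℂ)) k).symm⟩

/-- Source of all domain elements used below: finitely many nonzero smooth pieces whose end values
match. Each `η k` is smooth on the whole line, but only its restriction to interval `k` counts. -/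
theorem exists_mem_preHamiltonianGraph {X : Centers} {α : ℕ → ℝ} {q : ℝ → ℝ}
    (hq : MemLp q ∞ halfLine) {η : ℕ → ℝ → ℝ} (hη : ∀ k, ContDiff ℝ ∞ (η k)) {N : ℕ}
    (hN : ∀ k, N ≤ k → η k = 0)
    (hm : Matches X α (fun k t => (η k t : ℂ)) (fun k t => (deriv (η k) t : ℝ))) :
    ∃ g k : L2Half, (g, k) ∈ preHamiltonianGraph X α q ∧
      g =ᵐ[halfLine] glue X (fun k t => (η k t : ℂ)) ∧
      k =ᵐ[halfLine] fun t => -glue X (fun k t => (deriv (deriv (η k)) t : ℝ)) t +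
        q t * glue X (fun k t => (η k t : ℂ)) t := by
  have hp := hasPieces_glue X hη
  have c : ∀ k, Continuous (deriv (deriv (η k))) := fun k =>
    (contDiff_infty_iff_deriv.1 (contDiff_infty_iff_deriv.1 (hη k)).2).2.continuous
  have m1 : ∀ p, MemLp (glue X fun k t => (η k t : ℂ)) p halfLine := fun p =>
    memLp_glue X (N := N) (fun k hk => by ext t; simp [hN k hk])
      (fun k => Complex.continuous_ofReal.comp (hη k).continuous) p
  have m2 : ∀ p, MemLp (glue X fun k t => (deriv (deriv (η k)) t : ℝ)) p halfLine := fun p =>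
    memLp_glue X (N := N) (fun k hk => by ext t; simp [hN k hk])
      (fun k => Complex.continuous_ofReal.comp (c k)) p
  have m3 : MemLp (fun t => -glue X (fun k t => (deriv (deriv (η k)) t : ℝ)) t +
        q t * glue X (fun k t => (η k t : ℂ)) t) 2 halfLine :=
    (m2 2).neg.add ((m1 2).mul hq.ofReal)
  refine ⟨(m1 2).toLp _, m3.toLp _, ⟨⟨?_, ?_⟩, ?_, ?_⟩, (m1 2).coeFn_toLp, m3.coeFn_toLp⟩
  · exact (hp.memPiecewiseSobolev (m1 1) (m2 1)).congr (m1 2).coeFn_toLp.symm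
  · exact (hasBoundedSupport_glue X (N := N) fun k hk => by ext t; simp [hN k hk]).congr
      (m1 2).coeFn_toLp.symm
  · exact (hp.deltaConditions_iff.2 hm).congr (m1 2).coeFn_toLp.symm
  · exact IsTau.congr ⟨_, hp.isPiecewiseDeriv_two, .rfl⟩ (m1 2).coeFn_toLp.symm m3.coeFn_toLp.symm

/-! ### The adjoint -/

/-- The test functions on the intervals between consecutive centres belong to the domain. -/
theorem exists_mem_preHamiltonianGraph_testFun {X : Centers} {q : ℝ → ℝ} (α : ℕ → ℝ)
    (hq : MemLp q ∞ halfLine) (j : ℕ) {φ : ℝ → ℝ} (hφ : ContDiff ℝ ∞ φ)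
    (hs : tsupport φ ⊆ Ioo (X.x j) (X.x (j + 1))) :
    ∃ g k : L2Half, (g, k) ∈ preHamiltonianGraph X α q ∧
      g =ᵐ[halfLine] (fun t => (φ t : ℂ)) ∧
      k =ᵐ[halfLine] fun t => -((iteratedDeriv 2 φ t : ℝ) : ℂ) + q t * φ t := by
  have hs1 : tsupport (deriv φ) ⊆ Ioo (X.x j) (X.x (j + 1)) :=
    (closure_minimal support_deriv_subset (isClosed_tsupport _)).trans hs
  have hs2 : tsupport (deriv (deriv φ)) ⊆ Ioo (X.x j) (X.x (j + 1)) :=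
    (closure_minimal support_deriv_subset (isClosed_tsupport _)).trans hs1
  -- No centre lies inside an interval, so `φ` and `φ'` vanish at all centres and the interface
  -- conditions are trivial.
  have hn : ∀ k, X.x k ∉ Ioo (X.x j) (X.x (j + 1)) := fun k h => by
    have h1 := X.strictMono.lt_iff_lt.1 h.1
    have h2 := X.strictMono.lt_iff_lt.1 h.2
    omega
  have z : ∀ k, φ (X.x k) = 0 := fun k => eq_zero_of_notMem_tsupport_subset hs (hn k)
  have z1 : ∀ k, deriv φ (X.x k) = 0 := fun k => eq_zero_of_notMem_tsupport_subset hs1 (hn k)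
  set η : ℕ → ℝ → ℝ := fun k => if k = j then φ else 0 with hη
  have ηj : η j = φ := by simp [hη]
  have ηk : ∀ k, k ≠ j → η k = 0 := fun k hk => by simp [hη, hk]
  have e : ∀ k i, η k (X.x i) = 0 := fun k i => by
    by_cases hk : k = j
    · rw [hk, ηj, z]
    · rw [ηk k hk]; rfl
  have e1 : ∀ k i, deriv (η k) (X.x i) = 0 := fun k i => by
    by_cases hk : k = j
    · rw [hk, ηj, z1]
    · rw [ηk k hk]; simp
  obtain ⟨g, k, h1, h2, h3⟩ := exists_mem_preHamiltonianGraph (α := α) hq (η := η)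
    (fun k => by
      by_cases hk : k = j
      · rwa [hk, ηj]
      · rw [ηk k hk]; exact contDiff_const) (N := j + 1) (fun k hk => ηk k (by omega))
    ⟨by rw [← X.x_zero, e, Complex.ofReal_zero], fun k => by rw [e, e],
      fun k => by rw [e, e1, e1]; simp⟩
  have g1 : glue X (fun k t => (η k t : ℂ)) = fun t => (φ t : ℂ) := by
    rw [glue_single X (j := j) fun k hk => by ext t; simp [ηk k hk], ηj]
    exact indicator_eq_self.2 fun t ht => by
      by_contra hn
      exact ht (by simp [eq_zero_of_notMem_tsupport_subset hs hn])
  have g2 : glue X (fun k t => ((deriv (deriv (η k)) t : ℝ) : ℂ)) =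
      fun t => ((iteratedDeriv 2 φ t : ℝ) : ℂ) := by
    rw [glue_single X (j := j) fun k hk => by ext t; simp [ηk k hk], ηj, iteratedDeriv_succ',
      iteratedDeriv_one]
    exact indicator_eq_self.2 fun t ht => by
      by_contra hn
      exact ht (by simp [eq_zero_of_notMem_tsupport_subset hs2 hn])
  rw [g1] at h2 h3
  rw [g2] at h3
  exact ⟨g, k, h1, h2, h3⟩

theorem Centers.integral_halfLine_of_support (X : Centers) (j : ℕ) {Φ : ℝ → ℂ}
    (h : ∀ t, t ∉ Ioo (X.x j) (X.x (j + 1)) → Φ t = 0) : ∫ t, Φ t ∂halfLine = ∫ t, Φ t :=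
  setIntegral_eq_integral_of_forall_compl_eq_zero fun t ht => h t fun h' => ht (X.Ioo_subset j h')

theorem Centers.locallyIntegrableOn_of_memLp (X : Centers) {g : ℝ → ℂ} (hg : MemLp g 2 halfLine)
    (j : ℕ) : LocallyIntegrableOn g (Ioo (X.x j) (X.x (j + 1))) :=
  IntegrableOn.locallyIntegrableOn
    ((hg.mono_measure (Measure.restrict_mono (X.Ioo_subset j) le_rfl)).integrable one_le_two)

/-- An element of `L²` that is orthogonal to the test functions on the intervals between consecutive
centres vanishes. -/
theorem eq_zero_of_inner_testFun {X : Centers} {h : L2Half}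
    (H : ∀ (j : ℕ) (φ : ℝ → ℝ), ContDiff ℝ ∞ φ → HasCompactSupport φ →
      tsupport φ ⊆ Ioo (X.x j) (X.x (j + 1)) → ∀ g : L2Half,
      g =ᵐ[halfLine] (fun t => (φ t : ℂ)) → inner ℂ g h = 0) : h = 0 := by
  refine Lp.ext (EventuallyEq.trans ?_ (Lp.coeFn_zero ℂ 2 halfLine).symm)
  refine X.ae_of_forall_Ioo fun j => ?_
  have hl : LocallyIntegrableOn h (Ioo (X.x j) (X.x (j + 1))) :=
    X.locallyIntegrableOn_of_memLp (Lp.memLp h) j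
  have key := isOpen_Ioo.ae_eq_zero_of_integral_contDiff_smul_eq_zero hl (fun φ hφ hc hs => by
    have hm : MemLp (fun t => (φ t : ℂ)) 2 halfLine :=
      ((Complex.continuous_ofReal.comp hφ.continuous).memLp_of_hasCompactSupport
        (hc.comp_left Complex.ofReal_zero)).restrict _
    have := H j φ hφ hc hs (hm.toLp _) hm.coeFn_toLp
    rw [L2.inner_def] at this
    rw [← this, ← X.integral_halfLine_of_support j fun t ht => by
      simp [eq_zero_of_notMem_tsupport_subset hs ht]]
    refine integral_congr_ae ?_
    filter_upwards [hm.coeFn_toLp] with t ht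
    rw [ht, RCLike.inner_apply, Complex.conj_ofReal, Complex.real_smul, mul_comm])
  exact (ae_restrict_iff' measurableSet_Ioo).2 key

/-- Tested against smooth functions supported inside one interval, the adjoint relation is the
distributional equation `-f'' + q f = h`. -/
theorem isTau_of_forall_inner_eq {X : Centers} {α : ℕ → ℝ} {q : ℝ → ℝ} (hq : MemLp q ∞ halfLine)
    {f h : L2Half} (H : ∀ g k : L2Half, (g, k) ∈ preHamiltonianGraph X α q →
      inner ℂ g h = inner ℂ k f) : IsTau X.x q f h := by
  have hl : ∀ {g : ℝ → ℂ} (j : ℕ), MemLp g 2 halfLine →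
      LocallyIntegrableOn g (Ioo (X.x j) (X.x (j + 1))) := fun j hg =>
    X.locallyIntegrableOn_of_memLp hg j
  have hqf : MemLp (fun t => (q t : ℂ) * f t) 2 halfLine := (Lp.memLp f).mul hq.ofReal
  refine ⟨fun t => q t * f t - h t, fun j => ⟨hl j (Lp.memLp f), hl j (hqf.sub (Lp.memLp h)),
    fun φ hφ hc hs => ?_⟩, by filter_upwards with t; ring⟩
  obtain ⟨g, k, h1, h2, h3⟩ := exists_mem_preHamiltonianGraph_testFun α hq j hφ hs
  have e := H g k h1
  have hs2 := (tsupport_iteratedDeriv_testFun φ 2).trans hs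
  have hc2 : HasCompactSupport (iteratedDeriv 2 φ) :=
    hc.of_isClosed_subset (isClosed_tsupport _) (tsupport_iteratedDeriv_testFun φ 2)
  have i0 := integrable_testFun_smul (hl j (Lp.memLp h)) hφ.continuous hc hs
  have i1 := integrable_testFun_smul (hl j hqf) hφ.continuous hc hs
  have i2 := integrable_testFun_smul (hl j (Lp.memLp f)) (continuous_iteratedDeriv_testFun hφ 2)
    hc2 hs2
  have e1 : inner ℂ g h = ∫ t, φ t • h t := by
    rw [L2.inner_def, ← X.integral_halfLine_of_support j fun t ht => by
      simp [eq_zero_of_notMem_tsupport_subset hs ht]]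
    refine integral_congr_ae ?_
    filter_upwards [h2] with t ht
    rw [ht, RCLike.inner_apply, Complex.conj_ofReal, Complex.real_smul, mul_comm]
  have e2 : inner ℂ k f = ∫ t, (φ t • ((q t : ℂ) * f t) - iteratedDeriv 2 φ t • f t) := by
    rw [L2.inner_def, ← X.integral_halfLine_of_support j fun t ht => by
      simp [eq_zero_of_notMem_tsupport_subset hs ht, eq_zero_of_notMem_tsupport_subset hs2 ht]]
    refine integral_congr_ae ?_
    filter_upwards [h3] with t ht
    rw [ht, RCLike.inner_apply]
    simp only [map_add, map_neg, map_mul, Complex.conj_ofReal, Complex.real_smul]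
    ring
  rw [e1, e2, integral_sub i1 i2] at e
  simp only [smul_sub]
  rw [integral_sub i1 i0, e]
  ring

/-! ### Recovering the interface conditions from the adjoint relation -/

/-- A cutoff function at the centre `x j` that vanishes near all other centres. -/
theorem Centers.exists_cutoff (X : Centers) (j : ℕ) :
    ∃ χ : ℝ → ℝ, ContDiff ℝ ∞ χ ∧ χ (X.x j) = 1 ∧ deriv χ (X.x j) = 0 ∧
      ∀ k, k ≠ j → χ (X.x k) = 0 ∧ deriv χ (X.x k) = 0 := by
  -- By monotonicity only the neighbouring centres matter; `x 0` has none on its left.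
  obtain ⟨δ, hδ, h⟩ : ∃ δ > 0, ∀ k, k ≠ j → δ ≤ |X.x k - X.x j| := by
    have up : ∀ k, j < k → X.x (j + 1) - X.x j ≤ |X.x k - X.x j| := fun k hk =>
      (sub_le_sub_right (X.strictMono.monotone hk) _).trans (le_abs_self _)
    rcases j with _ | i
    · exact ⟨_, sub_pos.2 (X.lt_succ 0), fun k hk => up k (Nat.pos_of_ne_zero hk)⟩
    · refine ⟨min (X.x (i + 1 + 1) - X.x (i + 1)) (X.x (i + 1) - X.x i),
        lt_min (sub_pos.2 (X.lt_succ _)) (sub_pos.2 (X.lt_succ _)), fun k hk => ?_⟩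
      rcases lt_or_gt_of_ne hk with hk | hk
      · rw [abs_sub_comm]
        exact (min_le_right _ _).trans ((sub_le_sub_left (X.strictMono.monotone
          (Nat.lt_succ_iff.1 hk)) _).trans (le_abs_self _))
      · exact (min_le_left _ _).trans (up k hk)
  let B : ContDiffBump (X.x j) := ⟨δ / 4, δ / 2, by linarith, by linarith⟩
  have h1 : (B : ℝ → ℝ) =ᶠ[𝓝 (X.x j)] fun _ => 1 := B.eventuallyEq_one
  refine ⟨B, B.contDiff, h1.eq_of_nhds, by rw [h1.deriv_eq, deriv_const], fun k hk => ?_⟩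
  have h2 : (B : ℝ → ℝ) =ᶠ[𝓝 (X.x k)] fun _ => 0 := by
    have h3 : (Metric.closedBall (X.x j) (δ / 2))ᶜ ∈ 𝓝 (X.x k) := by
      refine Metric.isClosed_closedBall.isOpen_compl.mem_nhds fun hm => ?_
      have := h k hk
      rw [Metric.mem_closedBall, Real.dist_eq] at hm
      linarith
    filter_upwards [h3] with t ht
    refine B.zero_of_le_dist ?_
    have := not_le.1 fun h => ht (Metric.mem_closedBall.2 h)
    exact this.le
  exact ⟨h2.eq_of_nhds, by rw [h2.deriv_eq, deriv_const]⟩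

/-- A domain element living near one centre may have any value `c` and one-sided slopes `a`, `b`
there with `b - a = α c`. Green's formula then leaves only the boundary form at that centre, and
suitable data isolate each condition on `f`. -/
theorem matches_of_forall_inner_eq {X : Centers} {α : ℕ → ℝ} {q : ℝ → ℝ}
    (hq : MemLp q ∞ halfLine) {f h : L2Half} {f₂ : ℝ → ℂ} {u v : ℕ → ℝ → ℂ}
    (hp : HasPieces X f f₂ u v) (hh : h =ᵐ[halfLine] fun t => -f₂ t + q t * f t)
    (H : ∀ g k : L2Half, (g, k) ∈ preHamiltonianGraph X α q → inner ℂ h g = inner ℂ f k) :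
    Matches X α u v := by
  have main : ∀ (η : ℕ → ℝ → ℝ), (∀ k, ContDiff ℝ ∞ (η k)) → ∀ N, (∀ k, N ≤ k → η k = 0) →
      Matches X α (fun k t => (η k t : ℂ)) (fun k t => (deriv (η k) t : ℝ)) →
      ∑ j ∈ Finset.range N,
      ((starRingEnd ℂ (u j (X.x (j + 1))) * (deriv (η j) (X.x (j + 1)) : ℝ) -
          starRingEnd ℂ (v j (X.x (j + 1))) * η j (X.x (j + 1))) -
        (starRingEnd ℂ (u j (X.x j)) * (deriv (η j) (X.x j) : ℝ) -
          starRingEnd ℂ (v j (X.x j)) * η j (X.x j))) = 0 := by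
    intro η hη N hN hm
    obtain ⟨g, k, h1, h2, h3⟩ := exists_mem_preHamiltonianGraph hq hη hN hm
    have hg := hasPieces_glue X hη
    have hg' : HasPieces X g _ _ _ := ⟨fun k =>
      (ae_restrict_of_halfLine h2 (X.Ioo_subset k)).trans (hg.ae_eq k), hg.fst, hg.snd⟩
    rw [← inner_sub_inner_eq_sum hp hh hg' (h3.trans ?_), H g k h1, sub_self]
    · refine X.ae_of_forall_Ioo fun k => ?_
      filter_upwards [hg'.ae_eq k, ae_restrict_mem measurableSet_Ioo] with t e1 e2 e3
      have : N ≤ k := Nat.lt_succ_iff.1 (X.strictMono.lt_iff_lt.1 (e3.trans e2.2))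
      rw [e1, hN k this]
      simp
    · filter_upwards [h2] with t ht
      rw [ht]
  -- At a point `p` where `χ = 1` and `χ' = 0`, the product has value `c` and slope `s`.
  have piece : ∀ (χ : ℝ → ℝ) (p c s : ℝ), ContDiff ℝ ∞ χ →
      ContDiff ℝ ∞ (fun t => χ t * (c + s * (t - p))) ∧ ∀ t,
        deriv (fun t => χ t * (c + s * (t - p))) t = deriv χ t * (c + s * (t - p)) + χ t * s := by
    intro χ p c s hχ
    refine ⟨hχ.mul (contDiff_const.add (contDiff_const.mul (contDiff_id.sub contDiff_const))),
      fun t => ?_⟩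
    have h1 : HasDerivAt (fun t => c + s * (t - p)) s t := by
      simpa using (((hasDerivAt_id t).sub_const p).const_mul s).const_add c
    exact (((contDiff_infty_iff_deriv.1 hχ).1 t).hasDerivAt.mul h1).deriv
  have interior : ∀ (i : ℕ) (c a b : ℝ), b - a = α (i + 1) * c →
      starRingEnd ℂ (u i (X.x (i + 1))) * a - starRingEnd ℂ (v i (X.x (i + 1))) * c =
      starRingEnd ℂ (u (i + 1) (X.x (i + 1))) * b -
        starRingEnd ℂ (v (i + 1) (X.x (i + 1))) * c := by
    intro i c a b hab
    obtain ⟨χ, hχ, χ1, χ2, χ3⟩ := X.exists_cutoff (i + 1)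
    set η : ℕ → ℝ → ℝ := fun k =>
      if k = i then fun t => χ t * (c + a * (t - X.x (i + 1)))
      else if k = i + 1 then fun t => χ t * (c + b * (t - X.x (i + 1))) else 0 with hη
    have η1 : η i = fun t => χ t * (c + a * (t - X.x (i + 1))) := by simp [hη]
    have η2 : η (i + 1) = fun t => χ t * (c + b * (t - X.x (i + 1))) := by simp [hη]
    have η3 : ∀ k, k ≠ i → k ≠ i + 1 → η k = 0 := fun k h1 h2 => by simp [hη, h1, h2]
    have far : ∀ k l, l ≠ i + 1 → η k (X.x l) = 0 ∧ deriv (η k) (X.x l) = 0 := by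
      intro k l hl
      by_cases hk : k = i
      · rw [hk, η1, (piece _ _ _ _ hχ).2, (χ3 l hl).2]; simp [(χ3 l hl).1]
      by_cases hk' : k = i + 1
      · rw [hk', η2, (piece _ _ _ _ hχ).2, (χ3 l hl).2]; simp [(χ3 l hl).1]
      · rw [η3 k hk hk']; simp
    have n1 : η i (X.x (i + 1)) = c := by simp [η1, χ1]
    have n2 : η (i + 1) (X.x (i + 1)) = c := by simp [η2, χ1]
    have n3 : deriv (η i) (X.x (i + 1)) = a := by
      rw [η1, (piece _ _ _ _ hχ).2, χ1, χ2]; ring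
    have n4 : deriv (η (i + 1)) (X.x (i + 1)) = b := by
      rw [η2, (piece _ _ _ _ hχ).2, χ1, χ2]; ring
    have hsmooth : ∀ k, ContDiff ℝ ∞ (η k) := fun k => by
      by_cases hk : k = i
      · rw [hk, η1]; exact (piece _ _ _ _ hχ).1
      by_cases hk' : k = i + 1
      · rw [hk', η2]; exact (piece _ _ _ _ hχ).1
      · rw [η3 k hk hk']; exact contDiff_const
    have S := main η hsmooth (i + 2) (fun k hk => η3 k (by omega) (by omega)) ⟨?_, ?_, ?_⟩
    · rw [Finset.sum_range_succ, Finset.sum_range_succ, Finset.sum_eq_zero, n1, n2, n3, n4,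
        (far i i (by omega)).1, (far i i (by omega)).2, (far (i + 1) (i + 1 + 1) (by omega)).1,
        (far (i + 1) (i + 1 + 1) (by omega)).2] at S
      · simp only [Complex.ofReal_zero] at S
        linear_combination S
      · intro k hk
        have hk := Finset.mem_range.1 hk
        rw [η3 k (by omega) (by omega)]
        simp
    · have := (far 0 0 (by omega)).1
      rw [X.x_zero] at this
      simp [this]
    · intro k
      by_cases hk : k = i
      · rw [hk, n1, n2]
      · rw [(far k (k + 1) (by omega)).1, (far (k + 1) (k + 1) (by omega)).1]
    · intro k
      by_cases hk : k = i
      · rw [hk, n1, n3, n4, ← Complex.ofReal_sub, hab, Complex.ofReal_mul]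
      · rw [(far k (k + 1) (by omega)).1, (far k (k + 1) (by omega)).2,
          (far (k + 1) (k + 1) (by omega)).2]
        simp
  -- Data `c = 0`, `a = b = 1` compare the two values of `f`.
  have hval : ∀ i, u i (X.x (i + 1)) = u (i + 1) (X.x (i + 1)) := fun i =>
    (starRingEnd ℂ).injective (by simpa using interior i 0 1 1 (by simp))
  refine ⟨?_, hval, fun i => ?_⟩
  -- At `0` the admissible data are value `0` and arbitrary slope; slope `1` yields `f(0) = 0`.
  · obtain ⟨χ, hχ, χ1, χ2, χ3⟩ := X.exists_cutoff 0
    set η : ℕ → ℝ → ℝ := fun k =>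
      if k = 0 then fun t => χ t * (0 + 1 * (t - X.x 0)) else 0 with hη
    have η1 : η 0 = fun t => χ t * (0 + 1 * (t - X.x 0)) := by simp [hη]
    have η3 : ∀ k, k ≠ 0 → η k = 0 := fun k h1 => by simp [hη, h1]
    have far : ∀ k l, l ≠ 0 → η k (X.x l) = 0 ∧ deriv (η k) (X.x l) = 0 := by
      intro k l hl
      by_cases hk : k = 0
      · rw [hk, η1, (piece _ _ _ _ hχ).2, (χ3 l hl).2]; simp [(χ3 l hl).1]
      · rw [η3 k hk]; simp
    have n1 : η 0 (X.x 0) = 0 := by simp [η1]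
    have n3 : deriv (η 0) (X.x 0) = 1 := by
      rw [η1, (piece _ _ _ _ hχ).2, χ1, χ2]; ring
    have S := main η (fun k => by
      by_cases hk : k = 0
      · rw [hk, η1]; exact (piece _ _ _ _ hχ).1
      · rw [η3 k hk]; exact contDiff_const) 1 (fun k hk => η3 k (by omega))
      ⟨by rw [← X.x_zero, n1, Complex.ofReal_zero], fun k => by
        rw [(far k (k + 1) (by omega)).1, (far (k + 1) (k + 1) (by omega)).1], fun k => by
        rw [(far k (k + 1) (by omega)).1, (far k (k + 1) (by omega)).2,
          (far (k + 1) (k + 1) (by omega)).2]; simp⟩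
    rw [Finset.sum_range_one, (far 0 (0 + 1) (by omega)).1, (far 0 (0 + 1) (by omega)).2, n1,
      n3, X.x_zero] at S
    simpa using S
  -- Data `c = 1`, `a = 0`, `b = α` give the jump of `f'`.
  · have e := interior i 1 0 (α (i + 1)) (by simp)
    rw [← hval i] at e
    refine (starRingEnd ℂ).injective ?_
    rw [map_sub, map_mul, Complex.conj_ofReal]
    push_cast at e
    linear_combination e

/-! ### The closure and its adjoint -/

section Operator

variable {X : Centers} {α : ℕ → ℝ} {q : ℝ → ℝ}

theorem mem_graph_preHamiltonian_iff {z : L2Half × L2Half} :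
    z ∈ (preHamiltonian X α q).graph ↔ z ∈ preHamiltonianGraph X α q := by
  rw [graph_preHamiltonian]

/-- Test functions inside the intervals lie in the domain, and only zero is orthogonal to all of
them. -/
theorem dense_domain_preHamiltonian (hq : MemLp q ∞ halfLine) :
    Dense ((preHamiltonian X α q).domain : Set L2Half) := by
  rw [Submodule.dense_iff_topologicalClosure_eq_top, Submodule.topologicalClosure_eq_top_iff,
    Submodule.eq_bot_iff]
  refine fun h hh => eq_zero_of_inner_testFun (X := X) fun j φ hφ _ hs g hg => ?_
  obtain ⟨g', k, h1, h2, -⟩ := exists_mem_preHamiltonianGraph_testFun α hq j hφ hs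
  have e : g = g' := Lp.ext (hg.trans h2.symm)
  rw [e]
  exact (Submodule.mem_orthogonal _ _).1 hh g'
    (LinearPMap.mem_domain_of_mem_graph (mem_graph_preHamiltonian_iff.2 h1))

theorem isFormalAdjoint_preHamiltonian (hq : MemLp q ∞ halfLine) :
    (preHamiltonian X α q).IsFormalAdjoint (preHamiltonian X α q) := fun x y => by
  have hx := mem_graph_preHamiltonian_iff.1 ((preHamiltonian X α q).mem_graph x)
  exact inner_eq_of_isTau hq hx.2.2 hx.2.1
    (mem_graph_preHamiltonian_iff.1 ((preHamiltonian X α q).mem_graph y))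

/-- A densely defined symmetric operator is contained in its adjoint, which is closed. -/
theorem isClosable_preHamiltonian (hq : MemLp q ∞ halfLine) :
    (preHamiltonian X α q).IsClosable :=
  LinearPMap.isClosable_iff_exists_closed_extension.2
    ⟨_, LinearPMap.adjoint_isClosed (dense_domain_preHamiltonian hq),
      (isFormalAdjoint_preHamiltonian hq).le_adjoint (dense_domain_preHamiltonian hq)⟩

theorem dense_domain_hamiltonian (hq : MemLp q ∞ halfLine) :
    Dense ((hamiltonian X α q).domain : Set L2Half) :=
  (dense_domain_preHamiltonian hq).mono (preHamiltonian X α q).le_closure.1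

theorem graph_hamiltonian (hq : MemLp q ∞ halfLine) :
    (hamiltonian X α q).graph = (preHamiltonianGraph X α q).topologicalClosure := by
  rw [hamiltonian, ← (isClosable_preHamiltonian hq).graph_closure_eq_closure_graph,
    graph_preHamiltonian]

theorem mem_graph_adjoint_iff (hq : MemLp q ∞ halfLine) {f h : L2Half} :
    (f, h) ∈ (hamiltonian X α q).adjoint.graph ↔
      IsTau X.x q f h ∧ DeltaConditions X.x α f := by
  rw [LinearPMap.adjoint_graph_eq_graph_adjoint (dense_domain_hamiltonian hq),
    Submodule.mem_adjoint_iff, graph_hamiltonian hq]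
  constructor
  · intro H
    have H' : ∀ g k : L2Half, (g, k) ∈ preHamiltonianGraph X α q → inner ℂ g h = inner ℂ k f :=
      fun g k hg => (sub_eq_zero.1 (H g k (Submodule.le_topologicalClosure _ hg))).symm
    have hτ := isTau_of_forall_inner_eq hq H'
    obtain ⟨f₂, u, v, hp, -, hh⟩ := hτ.exists_hasPieces hq (Lp.memLp f) (Lp.memLp h)
    refine ⟨hτ, hp.deltaConditions_iff.2 (matches_of_forall_inner_eq hq hp hh fun g k hg => ?_)⟩
    rw [← inner_conj_symm, H' g k hg, inner_conj_symm]
  · rintro ⟨hτ, hδ⟩ g k hg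
    -- For fixed `f` and `h` the adjoint relation is closed, so it passes from `H⁰` to its closure.
    have hc : IsClosed {z : L2Half × L2Half | inner ℂ z.2 f - inner ℂ z.1 h = 0} :=
      isClosed_eq (by fun_prop) continuous_const
    refine closure_minimal (s := (preHamiltonianGraph X α q : Set (L2Half × L2Half)))
      (fun z hz => ?_) hc hg
    have := inner_eq_of_isTau hq hτ hδ (g := z.1) (k := z.2) hz
    rw [mem_ofPred_eq, ← inner_conj_symm, ← this, inner_conj_symm, sub_self]

theorem hamiltonian_le_adjoint (hq : MemLp q ∞ halfLine) :
    hamiltonian X α q ≤ (hamiltonian X α q).adjoint := by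
  refine LinearPMap.le_of_le_graph ?_
  rw [graph_hamiltonian hq]
  exact Submodule.topologicalClosure_minimal _ (fun z hz => (mem_graph_adjoint_iff hq).2
    ⟨hz.2.2, hz.2.1⟩) (LinearPMap.adjoint_isClosed (dense_domain_hamiltonian hq))

theorem isFormalAdjoint_hamiltonian (hq : MemLp q ∞ halfLine) :
    (hamiltonian X α q).IsFormalAdjoint (hamiltonian X α q) := fun x y => by
  have h := hamiltonian_le_adjoint (X := X) (α := α) hq
  rw [h.2 (x := x) (y := ⟨x, h.1 x.2⟩) rfl]
  exact LinearPMap.adjoint_isFormalAdjoint (dense_domain_hamiltonian hq) ⟨x, h.1 x.2⟩ y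

/-- With `f` in `L²` and `q` bounded, `f''` is in `L²` exactly when `τ_q f` is. -/
theorem mem_domain_adjoint_iff (hq : MemLp q ∞ halfLine) (f : L2Half) :
    f ∈ (hamiltonian X α q).adjoint.domain ↔
      MemPiecewiseSobolev X.x 2 2 f ∧ DeltaConditions X.x α f := by
  constructor
  · intro hf
    have hg := (mem_graph_adjoint_iff hq).1 ((hamiltonian X α q).adjoint.mem_graph ⟨f, hf⟩)
    obtain ⟨f₂, u, v, hp, h₂, -⟩ := hg.1.exists_hasPieces hq (Lp.memLp _) (Lp.memLp _)
    exact ⟨hp.memPiecewiseSobolev (Lp.memLp _) h₂, hg.2⟩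
  · rintro ⟨⟨h1, -, f₂, h2, h3⟩, hδ⟩
    have hm : MemLp (fun t => -f₂ t + q t * f t) 2 halfLine := h3.neg.add (h1.mul hq.ofReal)
    exact LinearPMap.mem_domain_of_mem_graph ((mem_graph_adjoint_iff (h := hm.toLp _) hq).2
      ⟨⟨f₂, h2, hm.coeFn_toLp⟩, hδ⟩)

theorem continuouslyEmbedded_adjoint (hq : MemLp q ∞ halfLine) :
    ContinuouslyEmbedded (hamiltonian X α q).domain (hamiltonian X α q).adjoint.domain
      (graphNorm (hamiltonian X α q)) (graphNorm (hamiltonian X α q).adjoint) := by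
  have h := hamiltonian_le_adjoint (X := X) (α := α) hq
  -- The adjoint extends `H`, so the two graph norms agree on the smaller domain.
  refine ⟨h.1, 1, fun f => ?_⟩
  rw [one_mul, graphNorm, graphNorm, h.2 (x := f) (y := Submodule.inclusion h.1 f) rfl]
  rfl

end Operator

/-! ### The embedding into `W^{1,2}` -/

/-- The values of a function and of its derivative at the end points of an interval are controlled
by the function and its second derivative. -/
theorem exists_endpoint_bound {d : ℝ} (hd : 0 < d) : ∃ K : ℝ, 0 ≤ K ∧
    ∀ (l r : ℝ) (u v f : ℝ → ℂ), r - l = d → IsPrimitiveOn l r u v → IsPrimitiveOn l r v f →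
      ‖u l‖ ≤ K * (∫ t in l..r, (‖u t‖ + ‖f t‖)) ∧ ‖v l‖ ≤ K * (∫ t in l..r, (‖u t‖ + ‖f t‖)) ∧
      ‖u r‖ ≤ K * (∫ t in l..r, (‖u t‖ + ‖f t‖)) ∧
      ‖v r‖ ≤ K * (∫ t in l..r, (‖u t‖ + ‖f t‖)) := by
  -- The sum of the two constants found in `hval`, one for `u` and one for `v`.
  refine ⟨(1 / d + 3 / d ^ 2) * (d ^ 2 + 2) + (1 / d ^ 2 + 2 / d ^ 3) * (d ^ 3 + 6 * d),
    by positivity, fun l r u v f hlr hu hv => ?_⟩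
  have hle : l ≤ r := by linarith
  set J := ∫ t in l..r, (‖u t‖ + ‖f t‖) with hJ
  have hui := hu.intervalIntegrable hle
  have hJ0 : 0 ≤ J := intervalIntegral.integral_nonneg hle fun t _ => by positivity
  -- The cubic `c₂ (t - e)² + c₃ (t - e)³` vanishes to second order at the end point `e`, so Green's
  -- formula against it sees only the other end point `o`.
  have hpoly : ∀ e c₂ c₃ t : ℝ,
      HasDerivAt (fun t => c₂ * (t - e) ^ 2 + c₃ * (t - e) ^ 3)
        (2 * c₂ * (t - e) + 3 * c₃ * (t - e) ^ 2) t ∧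
      HasDerivAt (fun t => 2 * c₂ * (t - e) + 3 * c₃ * (t - e) ^ 2)
        (2 * c₂ + 6 * c₃ * (t - e)) t := by
    intro e c₂ c₃ t
    have h0 : HasDerivAt (fun t => t - e) 1 t := (hasDerivAt_id t).sub_const e
    refine ⟨(((h0.pow 2).const_mul c₂).add ((h0.pow 3).const_mul c₃)).congr_deriv ?_,
      ((h0.const_mul (2 * c₂)).add ((h0.pow 2).const_mul (3 * c₃))).congr_deriv ?_⟩
    · push_cast; ring
    · push_cast; ring
  have key : ∀ e o c₂ c₃ : ℝ, (e = l ∧ o = r ∨ e = r ∧ o = l) →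
      ‖u o * ((2 * c₂ * (o - e) + 3 * c₃ * (o - e) ^ 2 : ℝ) : ℂ) -
        v o * ((c₂ * (o - e) ^ 2 + c₃ * (o - e) ^ 3 : ℝ) : ℂ)‖ ≤
      (|c₂| * (d ^ 2 + 2) + |c₃| * (d ^ 3 + 6 * d)) * J := by
    intro e o c₂ c₃ heo
    have p1 : IsPrimitiveOn l r (fun t => ((c₂ * (t - e) ^ 2 + c₃ * (t - e) ^ 3 : ℝ) : ℂ))
        (fun t => ((2 * c₂ * (t - e) + 3 * c₃ * (t - e) ^ 2 : ℝ) : ℂ)) :=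
      .of_hasDerivAt (fun t => (hpoly e c₂ c₃ t).1.ofReal_comp) (by fun_prop)
    have p2 : IsPrimitiveOn l r
        (fun t => ((2 * c₂ * (t - e) + 3 * c₃ * (t - e) ^ 2 : ℝ) : ℂ))
        (fun t => ((2 * c₂ + 6 * c₃ * (t - e) : ℝ) : ℂ)) :=
      .of_hasDerivAt (fun t => (hpoly e c₂ c₃ t).2.ofReal_comp) (by fun_prop)
    have hG := IsPrimitiveOn.green hle hu hv p1 p2
    have hb : ‖∫ t in l..r, (u t * ((2 * c₂ + 6 * c₃ * (t - e) : ℝ) : ℂ) -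
        f t * ((c₂ * (t - e) ^ 2 + c₃ * (t - e) ^ 3 : ℝ) : ℂ))‖ ≤
        (|c₂| * (d ^ 2 + 2) + |c₃| * (d ^ 3 + 6 * d)) * J := by
      rw [hJ, ← intervalIntegral.integral_const_mul]
      refine intervalIntegral.norm_integral_le_of_norm_le hle (.of_forall fun t ht => ?_)
        ((hui.norm.add hv.integrable.norm).const_mul _)
      have hs : |t - e| ≤ d := by
        rw [abs_le]
        rcases heo with ⟨rfl, rfl⟩ | ⟨rfl, rfl⟩ <;> constructor <;> linarith [ht.1, ht.2]
      have hs0 := abs_nonneg (t - e)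
      -- The factors `d ^ 2 + 2` and `d ^ 3 + 6 * d` are chosen to bound both the cubic and its
      -- second derivative.
      have b1 : |2 * c₂ + 6 * c₃ * (t - e)| ≤ |c₂| * (d ^ 2 + 2) + |c₃| * (d ^ 3 + 6 * d) := by
        calc |2 * c₂ + 6 * c₃ * (t - e)| ≤ |2 * c₂| + |6 * c₃ * (t - e)| := abs_add_le _ _
          _ = 2 * |c₂| + 6 * |c₃| * |t - e| := by
            rw [abs_mul, abs_mul, abs_mul]; norm_num
          _ ≤ 2 * |c₂| + 6 * |c₃| * d := by gcongr
          _ ≤ _ := by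
            have h1 : 0 ≤ |c₂| * d ^ 2 := by positivity
            have h2 : 0 ≤ |c₃| * d ^ 3 := by positivity
            linarith
      have b2 : |c₂ * (t - e) ^ 2 + c₃ * (t - e) ^ 3| ≤
          |c₂| * (d ^ 2 + 2) + |c₃| * (d ^ 3 + 6 * d) := by
        calc |c₂ * (t - e) ^ 2 + c₃ * (t - e) ^ 3|
            ≤ |c₂ * (t - e) ^ 2| + |c₃ * (t - e) ^ 3| := abs_add_le _ _
          _ = |c₂| * |t - e| ^ 2 + |c₃| * |t - e| ^ 3 := by simp only [abs_mul, abs_pow]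
          _ ≤ |c₂| * d ^ 2 + |c₃| * d ^ 3 := by gcongr
          _ ≤ _ := by
            have h1 : 0 ≤ |c₂| := abs_nonneg _
            have h2 : 0 ≤ |c₃| * d := by positivity
            linarith
      refine (norm_sub_le _ _).trans ?_
      rw [norm_mul, norm_mul, Complex.norm_real, Complex.norm_real, Real.norm_eq_abs,
        Real.norm_eq_abs, mul_add, mul_comm _ ‖u t‖, mul_comm _ ‖f t‖]
      gcongr
    rw [hG] at hb
    rcases heo with ⟨rfl, rfl⟩ | ⟨rfl, rfl⟩
    · simpa using hb
    · rw [← norm_neg]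
      refine le_trans (le_of_eq ?_) hb
      congr 1
      simp
  have habs : ∀ e o : ℝ, (e = l ∧ o = r ∨ e = r ∧ o = l) → |o - e| = d := by
    rintro e o (⟨rfl, rfl⟩ | ⟨rfl, rfl⟩)
    · rw [hlr, abs_of_pos hd]
    · rw [abs_sub_comm, hlr, abs_of_pos hd]
  have hval : ∀ e o : ℝ, (e = l ∧ o = r ∨ e = r ∧ o = l) →
      ‖u o‖ ≤ (1 / d * (d ^ 2 + 2) + 1 / d ^ 2 * (d ^ 3 + 6 * d)) * J ∧
      ‖v o‖ ≤ (3 / d ^ 2 * (d ^ 2 + 2) + 2 / d ^ 3 * (d ^ 3 + 6 * d)) * J := by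
    intro e o heo
    have ha := habs e o heo
    have hne : o - e ≠ 0 := by
      intro h0
      rw [h0, abs_zero] at ha
      exact hd.ne ha
    -- The first cubic has value `0` and slope `1` at `o`, which isolates `u o`; the second has
    -- value `1` and slope `0`, which isolates `v o`.
    have k1 := key e o (-1 / (o - e)) (1 / (o - e) ^ 2) heo
    have k2 := key e o (3 / (o - e) ^ 2) (-2 / (o - e) ^ 3) heo
    rw [show 2 * (-1 / (o - e)) * (o - e) + 3 * (1 / (o - e) ^ 2) * (o - e) ^ 2 = 1 by
        field_simp; norm_num,
      show -1 / (o - e) * (o - e) ^ 2 + 1 / (o - e) ^ 2 * (o - e) ^ 3 = 0 by field_simp; ring,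
      abs_div, abs_div, abs_pow, ha] at k1
    rw [show 2 * (3 / (o - e) ^ 2) * (o - e) + 3 * (-2 / (o - e) ^ 3) * (o - e) ^ 2 = 0 by
        field_simp; ring,
      show 3 / (o - e) ^ 2 * (o - e) ^ 2 + -2 / (o - e) ^ 3 * (o - e) ^ 3 = 1 by
        field_simp; norm_num,
      abs_div, abs_div, abs_pow, abs_pow, ha] at k2
    constructor
    · simpa using k1
    · simpa using k2
  have m1 : (1 / d * (d ^ 2 + 2) + 1 / d ^ 2 * (d ^ 3 + 6 * d)) * J ≤
      ((1 / d + 3 / d ^ 2) * (d ^ 2 + 2) + (1 / d ^ 2 + 2 / d ^ 3) * (d ^ 3 + 6 * d)) * J := by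
    gcongr
    · exact le_add_of_nonneg_right (by positivity)
    · exact le_add_of_nonneg_right (by positivity)
  have m2 : (3 / d ^ 2 * (d ^ 2 + 2) + 2 / d ^ 3 * (d ^ 3 + 6 * d)) * J ≤
      ((1 / d + 3 / d ^ 2) * (d ^ 2 + 2) + (1 / d ^ 2 + 2 / d ^ 3) * (d ^ 3 + 6 * d)) * J := by
    gcongr
    · exact le_add_of_nonneg_left (by positivity)
    · exact le_add_of_nonneg_left (by positivity)
  have hl := hval r l (.inr ⟨rfl, rfl⟩)
  have hr := hval l r (.inl ⟨rfl, rfl⟩)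
  exact ⟨hl.1.trans m1, hl.2.trans m2, hr.1.trans m1, hr.2.trans m2⟩

/-- The Cauchy–Schwarz inequality against the constant function one. -/
theorem sq_intervalIntegral_le {l r : ℝ} (h : l < r) {g : ℝ → ℝ}
    (hg : IntervalIntegrable g volume l r)
    (hg2 : IntervalIntegrable (fun t => g t ^ 2) volume l r) :
    (∫ t in l..r, g t) ^ 2 ≤ (r - l) * ∫ t in l..r, g t ^ 2 := by
  set I := ∫ t in l..r, g t
  -- The integrand is the square of `(r - l) g - I`.
  have h1 : 0 ≤ ∫ t in l..r, ((r - l) ^ 2 * g t ^ 2 - 2 * (r - l) * I * g t + I ^ 2) :=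
    intervalIntegral.integral_nonneg h.le fun t _ => by nlinarith [sq_nonneg ((r - l) * g t - I)]
  rw [intervalIntegral.integral_add ((hg2.const_mul _).sub (hg.const_mul _))
    intervalIntegrable_const, intervalIntegral.integral_sub (hg2.const_mul _) (hg.const_mul _),
    intervalIntegral.integral_const_mul, intervalIntegral.integral_const_mul,
    intervalIntegral.integral_const, smul_eq_mul] at h1
  have h2 : 0 < r - l := sub_pos.2 h
  have h3 : 0 ≤ (r - l) * ((r - l) * (∫ t in l..r, g t ^ 2) - I ^ 2) := by
    have e : ∫ t in l..r, g t = I := rfl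
    rw [e] at h1
    linarith
  linarith [nonneg_of_mul_nonneg_right h3 h2]

/-- On intervals of length at least `d`, the `L²` norm of the derivative is controlled by those of
the function and of its second derivative. -/
theorem exists_interpolation {d : ℝ} (hd : 0 < d) : ∃ C : ℝ, 0 ≤ C ∧
    ∀ (a b : ℝ) (u v f : ℝ → ℂ), d ≤ b - a → IsPrimitiveOn a b u v → IsPrimitiveOn a b v f →
      IntervalIntegrable (fun t => ‖f t‖ ^ 2) volume a b →
      ∫ t in a..b, ‖v t‖ ^ 2 ≤ C * ∫ t in a..b, (‖u t‖ ^ 2 + ‖f t‖ ^ 2) := by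
  obtain ⟨K, hK, H⟩ := exists_endpoint_bound hd
  -- Each of the two boundary terms costs `2 d K² S`, and `∫ conj(u) f` costs at most `S`.
  refine ⟨4 * d * K ^ 2 + 1, by positivity, fun a b u v f hab hu hv hf2 => ?_⟩
  have hle : a ≤ b := by linarith
  set S := ∫ t in a..b, (‖u t‖ ^ 2 + ‖f t‖ ^ 2) with hS
  have huc : ContinuousOn u (uIcc a b) := by rw [uIcc_of_le hle]; exact hu.continuousOn hle
  have hvc : ContinuousOn v (uIcc a b) := by rw [uIcc_of_le hle]; exact hv.continuousOn hle
  have hQ : IntervalIntegrable (fun t => ‖u t‖ ^ 2 + ‖f t‖ ^ 2) volume a b :=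
    (ContinuousOn.intervalIntegrable (huc.norm.pow 2)).add hf2
  -- Subintervals of length exactly `d` keep `K` independent of `b - a`.
  have hsub : ∀ l r, a ≤ l → l < r → r ≤ b → r - l = d →
      ‖u l‖ * ‖v l‖ ≤ K ^ 2 * (2 * d * S) ∧ ‖u r‖ * ‖v r‖ ≤ K ^ 2 * (2 * d * S) := by
    intro l r hal hlr hrb hd'
    have hss : uIcc l r ⊆ uIcc a b := by
      rw [uIcc_of_le hle, uIcc_of_le hlr.le]; exact Icc_subset_Icc hal hrb
    have hmem : l ∈ Icc a b := ⟨hal, hlr.le.trans hrb⟩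
    have restr : ∀ {P p : ℝ → ℂ}, IsPrimitiveOn a b P p → IsPrimitiveOn l r P p := fun hP => by
      refine ⟨hP.integrable.mono_set hss, fun t ht => ?_⟩
      have i1 := hP.integrable.mono_set (uIcc_subset_uIcc_left (Icc_subset_uIcc hmem))
      have i2 := hP.integrable.mono_set ((uIcc_subset_uIcc_left (Icc_subset_uIcc ht)).trans hss)
      rw [hP.eq t ⟨hal.trans ht.1, ht.2.trans hrb⟩, hP.eq l hmem,
        ← intervalIntegral.integral_add_adjacent_intervals i1 i2]
      ring
    obtain ⟨k1, k2, k3, k4⟩ := H l r u v f hd' (restr hu) (restr hv)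
    set J := ∫ t in l..r, (‖u t‖ + ‖f t‖) with hJ
    have hJ0 : 0 ≤ J := intervalIntegral.integral_nonneg hlr.le fun t _ => by positivity
    have hun : IntervalIntegrable (fun t => ‖u t‖) volume l r :=
      ((restr hu).intervalIntegrable hlr.le).norm
    have hfn : IntervalIntegrable (fun t => ‖f t‖) volume l r := (restr hv).integrable.norm
    have hsq : IntervalIntegrable (fun t => (‖u t‖ + ‖f t‖) ^ 2) volume l r := by
      have i3 : IntervalIntegrable (fun t => 2 * ‖u t‖ * ‖f t‖) volume l r :=
        hfn.continuousOn_mul ((huc.mono hss).norm.const_mul 2 |>.congr fun t _ => rfl)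
      exact ((hQ.mono_set hss).add i3).congr fun t _ => by ring
    have hJS : J ^ 2 ≤ 2 * d * S := by
      refine (sq_intervalIntegral_le hlr (hun.add hfn) hsq).trans ?_
      rw [hd', mul_comm 2 d, mul_assoc]
      refine mul_le_mul_of_nonneg_left ?_ hd.le
      calc ∫ t in l..r, (‖u t‖ + ‖f t‖) ^ 2
          ≤ ∫ t in l..r, 2 * (‖u t‖ ^ 2 + ‖f t‖ ^ 2) :=
            intervalIntegral.integral_mono_on hlr.le hsq ((hQ.mono_set hss).const_mul 2)
              fun t _ => by nlinarith [sq_nonneg (‖u t‖ - ‖f t‖)]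
        _ = 2 * ∫ t in l..r, (‖u t‖ ^ 2 + ‖f t‖ ^ 2) := intervalIntegral.integral_const_mul _ _
        _ ≤ 2 * S := by
            refine mul_le_mul_of_nonneg_left ?_ zero_le_two
            exact intervalIntegral.integral_mono_interval hal hlr.le hrb
              (.of_forall fun t => by positivity) hQ
    have fin : ∀ x y : ℝ, 0 ≤ x → 0 ≤ y → x ≤ K * J → y ≤ K * J → x * y ≤ K ^ 2 * (2 * d * S) :=
      fun x y hx hy h1 h2 => calc
        x * y ≤ (K * J) * (K * J) := mul_le_mul h1 h2 hy (hx.trans h1)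
        _ = K ^ 2 * J ^ 2 := by ring
        _ ≤ _ := by gcongr
    exact ⟨fin _ _ (norm_nonneg _) (norm_nonneg _) k1 k2,
      fin _ _ (norm_nonneg _) (norm_nonneg _) k3 k4⟩
  have ha := (hsub a (a + d) le_rfl (by linarith) (by linarith) (by ring)).1
  have hb := (hsub (b - d) b (by linarith) (by linarith) le_rfl (by ring)).2
  -- By parts: `∫ |v|²` equals the boundary values of `conj(u) v` minus `∫ conj(u) f`.
  have hI := IsPrimitiveOn.integral_mul hle hu.conj hv
  have huf : IntervalIntegrable (fun t => starRingEnd ℂ (u t) * f t) volume a b :=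
    hv.integrable.continuousOn_mul (Complex.continuous_conj.comp_continuousOn huc)
  have hvv : IntervalIntegrable (fun t => starRingEnd ℂ (v t) * v t) volume a b :=
    ContinuousOn.intervalIntegrable ((Complex.continuous_conj.comp_continuousOn hvc).mul hvc)
  have hvn : ∫ t in a..b, starRingEnd ℂ (v t) * v t = ((∫ t in a..b, ‖v t‖ ^ 2 : ℝ) : ℂ) := by
    rw [← intervalIntegral.integral_ofReal]
    refine intervalIntegral.integral_congr fun t _ => ?_
    simp only [Complex.conj_mul', Complex.ofReal_pow]
  rw [intervalIntegral.integral_add huf hvv, hvn] at hI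
  have hmid : ‖∫ t in a..b, starRingEnd ℂ (u t) * f t‖ ≤ S := by
    refine intervalIntegral.norm_integral_le_of_norm_le hle (.of_forall fun t _ => ?_) hQ
    rw [norm_mul, RCLike.norm_conj]
    nlinarith [sq_nonneg (‖u t‖ - ‖f t‖), sq_nonneg ‖u t‖, sq_nonneg ‖f t‖]
  have hnn : 0 ≤ ∫ t in a..b, ‖v t‖ ^ 2 :=
    intervalIntegral.integral_nonneg hle fun t _ => by positivity
  calc ∫ t in a..b, ‖v t‖ ^ 2 = ‖((∫ t in a..b, ‖v t‖ ^ 2 : ℝ) : ℂ)‖ := by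
        rw [Complex.norm_real, Real.norm_of_nonneg hnn]
    _ = ‖starRingEnd ℂ (u b) * v b - starRingEnd ℂ (u a) * v a -
          ∫ t in a..b, starRingEnd ℂ (u t) * f t‖ := by rw [← hI]; congr 1; ring
    _ ≤ ‖u b‖ * ‖v b‖ + ‖u a‖ * ‖v a‖ + S := by
        refine (norm_sub_le _ _).trans (add_le_add ((norm_sub_le _ _).trans ?_) hmid)
        rw [norm_mul, norm_mul, RCLike.norm_conj, RCLike.norm_conj]
    _ ≤ (4 * d * K ^ 2 + 1) * S := by linarith

/-- The intervals between consecutive centres fill the half-line. -/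
theorem Centers.halfLine_eq (X : Centers) :
    halfLine = volume.restrict (⋃ k, Ioo (X.x k) (X.x (k + 1))) := by
  have h1 : ∀ᵐ t ∂halfLine, t ∈ ⋃ k, Ioo (X.x k) (X.x (k + 1)) :=
    X.ae_of_forall_Ioo fun k => by
      filter_upwards [ae_restrict_mem measurableSet_Ioo] with t ht using mem_iUnion.2 ⟨k, ht⟩
  rw [← Measure.restrict_eq_self_of_ae_mem h1,
    Measure.restrict_restrict (.iUnion fun k => measurableSet_Ioo),
    inter_eq_left.2 (iUnion_subset X.Ioo_subset)]

theorem Centers.pairwise_disjoint (X : Centers) :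
    Pairwise (Function.onFun Disjoint fun k => Ioo (X.x k) (X.x (k + 1))) := fun _ _ hjk =>
  disjoint_left.2 fun _ h1 h2 => hjk (X.eq_of_mem_Ioo h1 h2)

/-- The integrals of `Q` over the intervals form a summable series, which dominates those of the
nonnegative `P`. -/
theorem Centers.integrable_of_forall_le (X : Centers) {P Q : ℝ → ℝ} (hQ : Integrable Q halfLine)
    (hP : ∀ t, 0 ≤ P t) (hPi : ∀ k, IntegrableOn P (Ioo (X.x k) (X.x (k + 1))))
    (hle : ∀ k, ∫ t in Ioo (X.x k) (X.x (k + 1)), P t ≤ ∫ t in Ioo (X.x k) (X.x (k + 1)), Q t) :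
    Integrable P halfLine ∧ ∫ t, P t ∂halfLine ≤ ∫ t, Q t ∂halfLine := by
  rw [X.halfLine_eq] at hQ ⊢
  have h1 := hasSum_integral_iUnion (fun _ => measurableSet_Ioo) X.pairwise_disjoint hQ
  have hPn : ∀ k, 0 ≤ ∫ t in Ioo (X.x k) (X.x (k + 1)), P t := fun k => integral_nonneg hP
  have h2 : IntegrableOn P (⋃ k, Ioo (X.x k) (X.x (k + 1))) :=
    integrableOn_iUnion_of_summable_integral_norm hPi (by
      simp only [Real.norm_of_nonneg (hP _)]
      exact Summable.of_nonneg_of_le hPn hle h1.summable)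
  exact ⟨h2, hasSum_le hle (hasSum_integral_iUnion (fun _ => measurableSet_Ioo)
    X.pairwise_disjoint h2) h1⟩

theorem norm_sq_eq_integral (f : L2Half) : ‖f‖ ^ 2 = ∫ t, ‖f t‖ ^ 2 ∂halfLine := by
  have h := inner_self_eq_norm_sq_to_K (𝕜 := ℂ) f
  rw [L2.inner_def] at h
  simp only [inner_self_eq_norm_sq_to_K] at h
  have h2 : ((∫ t, ‖f t‖ ^ 2 ∂halfLine : ℝ) : ℂ) = ((‖f‖ ^ 2 : ℝ) : ℂ) := by
    rw [← integral_complex_ofReal]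
    push_cast
    exact h
  exact (Complex.ofReal_injective h2).symm

namespace HasPieces

variable {X : Centers} {α : ℕ → ℝ} {f f₂ : ℝ → ℂ} {u v : ℕ → ℝ → ℂ}

/-- A function that is continuous at the centres has a weak derivative on the half-line. -/
theorem isWeakDeriv_glue (h : HasPieces X f f₂ u v) (hm : Matches X α u v)
    (hf : MemLp f 2 halfLine) (hv : MemLp (glue X v) 2 halfLine) :
    IsWeakDeriv (Ioi 0) 1 f (glue X v) := by
  have hl : ∀ {g : ℝ → ℂ}, MemLp g 2 halfLine → LocallyIntegrableOn g (Ioi 0) := fun hg =>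
    (locallyIntegrableOn_of_locallyIntegrable_restrict
      (hg.locallyIntegrable one_le_two)).mono_set Ioi_subset_Ici_self
  refine ⟨hl hf, hl hv, fun φ h1 h2 h3 => ?_⟩
  have hd : tsupport (deriv φ) ⊆ tsupport φ :=
    closure_minimal support_deriv_subset (isClosed_tsupport _)
  have hφd := (contDiff_infty_iff_deriv.1 h1).2.continuous
  have i1 := integrable_testFun_smul (hl hf) hφd h2.deriv (hd.trans h3)
  have i2 := integrable_testFun_smul (hl hv) h1.continuous h2 h3
  obtain ⟨R, hR⟩ := (IsCompact.bddAbove (h2 : IsCompact (tsupport φ)))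
  obtain ⟨N, hN⟩ := (X.tendsto.eventually_gt_atTop R).exists
  have hz : ∀ t, X.x N ≤ t → t ∉ tsupport φ := fun t ht hts =>
    absurd (hR hts) (not_le.2 (hN.trans_le ht))
  have e0 : ∫ t, (deriv φ t • f t + φ t • glue X v t) =
      ∫ t, (deriv φ t • f t + φ t • glue X v t) ∂halfLine :=
    (setIntegral_eq_integral_of_forall_compl_eq_zero fun t ht => by
      have hn : t ∉ tsupport φ := fun h => ht (Ioi_subset_Ici_self (h3 h))
      rw [image_eq_zero_of_notMem_tsupport hn,
        image_eq_zero_of_notMem_tsupport fun h => hn (hd h)]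
      simp).symm
  -- Each interval contributes the increment of `φ u`. Continuity of `f` at the centres makes the
  -- sum telescope, and `φ` vanishes at `x N`, which lies beyond its support.
  rw [integral_halfLine_eq_sum X (Φ := fun t => deriv φ t • f t + φ t • glue X v t)
      ((i1.add i2).restrict) (N := N) (.of_forall fun t ht => by
      rw [image_eq_zero_of_notMem_tsupport (hz t ht.le),
        image_eq_zero_of_notMem_tsupport fun h => hz t ht.le (hd h)]
      simp),
    Finset.sum_congr rfl fun k _ => show _ = (φ (X.x (k + 1)) : ℂ) *
      u (k + 1) (X.x (k + 1)) - φ (X.x k) * u k (X.x k) from ?_,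
    Finset.sum_range_sub fun k => (φ (X.x k) : ℂ) * u k (X.x k),
    image_eq_zero_of_notMem_tsupport (hz _ le_rfl), X.x_zero, hm.zero, integral_add i1 i2] at e0
  · rw [iteratedDeriv_one]
    simp only [Complex.ofReal_zero] at e0
    linear_combination e0
  · rw [← hm.value k, ← IsPrimitiveOn.integral_mul (X.lt_succ k).le (.of_testFun h1 _ _) (h.fst k)]
    have hb : ∀ᵐ s ∂(volume : Measure ℝ), s ≠ X.x (k + 1) :=
      (countable_singleton (X.x (k + 1))).ae_notMem volume
    refine intervalIntegral.integral_congr_ae ?_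
    filter_upwards [(ae_restrict_iff' measurableSet_Ioo).1 (h.ae_eq k), hb] with t e1 e2 ht
    rw [uIoc_of_le (X.lt_succ k).le] at ht
    have hmem : t ∈ Ioo (X.x k) (X.x (k + 1)) := ⟨ht.1, lt_of_le_of_ne ht.2 e2⟩
    rw [glue_of_mem X v hmem, e1 hmem, Complex.real_smul, Complex.real_smul]
    ring

/-- The constant `C` is the same for all intervals of length at least `d`, so the interpolation
inequality can be summed over `k`. -/
theorem memLp_glue_deriv (h : HasPieces X f f₂ u v) {d C : ℝ}
    (hC : ∀ (a b : ℝ) (u v f : ℝ → ℂ), d ≤ b - a → IsPrimitiveOn a b u v →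
      IsPrimitiveOn a b v f → IntervalIntegrable (fun t => ‖f t‖ ^ 2) volume a b →
      ∫ t in a..b, ‖v t‖ ^ 2 ≤ C * ∫ t in a..b, (‖u t‖ ^ 2 + ‖f t‖ ^ 2))
    (hd : ∀ k, d ≤ X.x (k + 1) - X.x k) (hf : MemLp f 2 halfLine) (hf₂ : MemLp f₂ 2 halfLine) :
    MemLp (glue X v) 2 halfLine ∧
      ∫ t, ‖glue X v t‖ ^ 2 ∂halfLine ≤ ∫ t, C * (‖f t‖ ^ 2 + ‖f₂ t‖ ^ 2) ∂halfLine := by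
  have hi : ∀ {g : ℝ → ℂ}, MemLp g 2 halfLine → Integrable (fun t => ‖g t‖ ^ 2) halfLine :=
    fun hg => (memLp_two_iff_integrable_sq_norm hg.1).1 hg
  have hvc : ∀ k, ContinuousOn (v k) (Icc (X.x k) (X.x (k + 1))) := fun k =>
    (h.snd k).continuousOn (X.lt_succ k).le
  have hvm : ∀ k, MemLp (glue X v) 2 (volume.restrict (Ioo (X.x k) (X.x (k + 1)))) := fun k =>
    (memLp_of_continuousOn_Icc (hvc k) 2).ae_eq (glue_ae_eq X v k).symm
  have hmeas : AEStronglyMeasurable (glue X v) halfLine := by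
    rw [X.halfLine_eq]
    exact aestronglyMeasurable_iUnion_iff.2 fun k => (hvm k).1
  have key := X.integrable_of_forall_le (P := fun t => ‖glue X v t‖ ^ 2)
    (((hi hf).add (hi hf₂)).const_mul C) (fun t => by positivity)
    (fun k => (memLp_two_iff_integrable_sq_norm (hvm k).1).1 (hvm k)) fun k => by
      have hle := (X.lt_succ k).le
      have e := hC _ _ _ _ _ (hd k) (h.fst k) (h.snd k)
        ((intervalIntegrable_iff_integrableOn_Ioo_of_le hle).2
          ((hi hf₂).mono_measure (Measure.restrict_mono (X.Ioo_subset k) le_rfl)))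
      rw [← intervalIntegral.integral_const_mul, intervalIntegral.integral_of_le hle,
        intervalIntegral.integral_of_le hle, integral_Ioc_eq_integral_Ioo,
        integral_Ioc_eq_integral_Ioo] at e
      refine le_trans (le_of_eq (integral_congr_ae ?_)) (e.trans (le_of_eq (integral_congr_ae ?_)))
      · filter_upwards [glue_ae_eq X v k] with t ht
        rw [ht]
      · filter_upwards [h.ae_eq k] with t ht
        simp only [Pi.add_apply, ht]
  exact ⟨(memLp_two_iff_integrable_sq_norm hmeas).2 key.1, key.2⟩

end HasPieces

theorem continuouslyEmbedded_W12 {X : Centers} {α : ℕ → ℝ} {q : ℝ → ℝ} (hq : MemLp q ∞ halfLine)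
    (hd : 0 < ⨅ k, (X.x (k + 1) - X.x k)) :
    ContinuouslyEmbedded (hamiltonian X α q).adjoint.domain W12
      (graphNorm (hamiltonian X α q).adjoint) W12Norm := by
  obtain ⟨C, hC0, hC⟩ := exists_interpolation hd
  -- A real infimum bounds its family only if the family is bounded below; here `0` is a lower
  -- bound.
  have hdk : ∀ k, (⨅ k, (X.x (k + 1) - X.x k)) ≤ X.x (k + 1) - X.x k := fun k =>
    ciInf_le ⟨0, by rintro _ ⟨k, rfl⟩; exact (sub_pos.2 (X.lt_succ k)).le⟩ k
  obtain ⟨M, hM0, hM⟩ : ∃ M : ℝ, 0 ≤ M ∧ ∀ᵐ t ∂halfLine, |q t| ≤ M := by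
    refine ⟨(eLpNormEssSup q halfLine).toReal, ENNReal.toReal_nonneg, ?_⟩
    have hfin : eLpNormEssSup q halfLine ≠ (⊤ : ℝ≥0∞) := by
      rw [← eLpNorm_exponent_top]; exact hq.2.ne
    filter_upwards [enorm_ae_le_eLpNormEssSup q halfLine] with t ht
    have := ENNReal.toReal_mono hfin ht
    rwa [toReal_enorm, Real.norm_eq_abs] at this
  -- From `f'' = q f - h` and `|q| ≤ M` one gets `|f''|² ≤ 2 M² |f|² + 2 |h|²`, to be inserted in
  -- the interpolation estimate.
  have main : ∀ f h : L2Half, (f, h) ∈ (hamiltonian X α q).adjoint.graph →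
      ∃ g : L2Half, (f, g) ∈ derivativeGraph ∧
        ‖g‖ ^ 2 ≤ C * ((1 + 2 * M ^ 2) * ‖f‖ ^ 2 + 2 * ‖h‖ ^ 2) := by
    intro f h hfh
    obtain ⟨hτ, hδ⟩ := (mem_graph_adjoint_iff hq).1 hfh
    obtain ⟨f₂, u, v, hp, h₂, hh⟩ := hτ.exists_hasPieces hq (Lp.memLp f) (Lp.memLp h)
    obtain ⟨hv, hle⟩ := hp.memLp_glue_deriv hC hdk (Lp.memLp f) h₂
    have hi : ∀ {g : ℝ → ℂ}, MemLp g 2 halfLine → Integrable (fun t => ‖g t‖ ^ 2) halfLine :=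
      fun hg => (memLp_two_iff_integrable_sq_norm hg.1).1 hg
    refine ⟨hv.toLp _, ?_, ?_⟩
    · exact (hp.isWeakDeriv_glue (hp.deltaConditions_iff.1 hδ) (Lp.memLp f) hv).congr
        measurableSet_Ioi .rfl (ae_restrict_of_halfLine hv.coeFn_toLp.symm Ioi_subset_Ici_self)
    · rw [norm_sq_eq_integral, norm_sq_eq_integral f, norm_sq_eq_integral h,
        ← integral_const_mul, ← integral_const_mul,
        ← integral_add ((hi (Lp.memLp f)).const_mul _) ((hi (Lp.memLp h)).const_mul _),
        ← integral_const_mul]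
      refine le_trans (le_of_eq (integral_congr_ae ?_)) (hle.trans (integral_mono_ae
        (((hi (Lp.memLp f)).add (hi h₂)).const_mul C)
        ((((hi (Lp.memLp f)).const_mul _).add ((hi (Lp.memLp h)).const_mul _)).const_mul C) ?_))
      · filter_upwards [hv.coeFn_toLp] with t ht
        rw [ht]
      · filter_upwards [hM, hh] with t e1 e2
        have e3 : ‖f₂ t‖ ≤ M * ‖f t‖ + ‖h t‖ := by
          have : f₂ t = q t * f t - h t := by rw [e2]; ring
          rw [this]
          refine (norm_sub_le _ _).trans (add_le_add_left ?_ _)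
          rw [norm_mul, Complex.norm_real, Real.norm_eq_abs]
          gcongr
        refine mul_le_mul_of_nonneg_left ?_ hC0
        have e4 : ‖f₂ t‖ ^ 2 ≤ (M * ‖f t‖ + ‖h t‖) ^ 2 := by gcongr
        nlinarith [sq_nonneg (M * ‖f t‖ - ‖h t‖)]
  have hsub : (hamiltonian X α q).adjoint.domain ≤ W12 := fun f hf => by
    obtain ⟨g, hg, -⟩ := main f _ ((hamiltonian X α q).adjoint.mem_graph ⟨f, hf⟩)
    rw [← graph_weakDerivative] at hg
    exact LinearPMap.mem_domain_of_mem_graph hg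
  -- The constant adds the coefficients of `‖f‖²` and `‖h‖²` in the bound for `‖f‖² + ‖g‖²`.
  refine ⟨hsub, √(1 + C * (1 + 2 * M ^ 2) + 2 * C), fun f => ?_⟩
  obtain ⟨g, hg, hn⟩ := main f _ ((hamiltonian X α q).adjoint.mem_graph f)
  rw [← graph_weakDerivative, LinearPMap.mem_graph_iff] at hg
  obtain ⟨y, hy1, hy2⟩ := hg
  have hy : y = Submodule.inclusion hsub f := Subtype.ext hy1
  rw [W12Norm, graphNorm, ← Real.sqrt_mul (by positivity), ← hy, hy2, hy1]
  refine Real.sqrt_le_sqrt ?_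
  have n1 : 0 ≤ ‖(f : L2Half)‖ ^ 2 := by positivity
  have n2 : 0 ≤ ‖(hamiltonian X α q).adjoint f‖ ^ 2 := by positivity
  have n3 : 0 ≤ C * (1 + 2 * M ^ 2) := by positivity
  simp only at hn ⊢
  nlinarith [mul_nonneg hC0 n1, mul_nonneg n3 n2]

end DeltaInteraction

end

/-! ### The theorem -/

open DeltaInteraction

theorem proposition2p1 (X : Centers) (α : ℕ → ℝ) (q : ℝ → ℝ) (hq : MemLp q ∞ halfLine) :
    -- the definition of `H` as a closure makes sense, and `H` is symmetric
    ((preHamiltonian X α q).IsClosable ∧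
      Dense ((hamiltonian X α q).domain : Set L2Half) ∧
      (hamiltonian X α q).IsFormalAdjoint (hamiltonian X α q)) ∧
    -- the adjoint: its domain and its action
    (∀ f : L2Half, f ∈ (hamiltonian X α q).adjoint.domain ↔
      MemPiecewiseSobolev X.x 2 2 f ∧ DeltaConditions X.x α f) ∧
    (∀ f : (hamiltonian X α q).adjoint.domain,
      IsTau X.x q (f : L2Half) ((hamiltonian X α q).adjoint f)) ∧
    -- the embeddings, for a positive distance between the centres
    (0 < ⨅ k, (X.x (k + 1) - X.x k) →
      ContinuouslyEmbedded (hamiltonian X α q).domain (hamiltonian X α q).adjoint.domain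
        (graphNorm (hamiltonian X α q)) (graphNorm (hamiltonian X α q).adjoint) ∧
      ContinuouslyEmbedded (hamiltonian X α q).adjoint.domain W12
        (graphNorm (hamiltonian X α q).adjoint) W12Norm) :=
  ⟨⟨isClosable_preHamiltonian hq, dense_domain_hamiltonian hq, isFormalAdjoint_hamiltonian hq⟩,
    mem_domain_adjoint_iff hq,
    fun f => ((mem_graph_adjoint_iff hq).1 ((hamiltonian X α q).adjoint.mem_graph f)).1,
    fun hd => ⟨continuouslyEmbedded_adjoint hq, continuouslyEmbedded_W12 hq hd⟩⟩
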